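/- All graphs are finite, simple and have at least one vertex. For a graph $G$, let $\delta(G)$ be its minimum degree. An $(s,t)$-bipartite-hole in $G$ is a pair of disjoint vertex sets $S,T$ with $|S|=s$, $|T|=t$ and no edge of $G$ between $S$ and $T$. The bipartite-hole-number $\widetilde{\alpha}(G)$ is the minimum integer $k$ such that there are positive integers $s,t$ with $s+t=k+1$ for which $G$ contains no $(s,t)$-bipartite-hole. A graph is traceable if it contains a Hamilton path (a path through all vertices; the one-vertex graph is traceable). Write $G\vee H$ for the join of $G$ and $H$, and $mH$ for the disjoint union of $m$ copies of $H$. Corollary. Let $G$ be a graph of order $n$ with $\delta(G)\ge \widetilde{\alpha}(G)-2$. Then $G$ is traceable unless $n$ is even and $G$ is isomorphic to $G_{\frac{n-2}{2}}\vee \frac{n+2}{2}K_1$ for some graph $G_{\frac{n-2}{2}}$ of order $\frac{n-2}{2}$ (arbitrary; it has no vertices when $n=2$), or to $2K_{\frac n2}$; in these exceptional cases $G$ is not traceable. -/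

import Mathlib

namespace SimpleGraph

/-- The join of two graphs: their disjoint union together with all edges joining
a vertex of the first graph to a vertex of the second. -/
def graphJoin {V W : Type*} (G : SimpleGraph V) (H : SimpleGraph W) : SimpleGraph (V ⊕ W) :=
  (G ⊕g H) ⊔ completeBipartiteGraph V W

/-- `G` contains an `(s, t)`-bipartite-hole: two disjoint vertex sets of sizes `s` and `t`
with no edge of `G` between them. -/
def HasBipartiteHole {V : Type*} (G : SimpleGraph V) (s t : ℕ) : Prop :=
  ∃ S T : Finset V, Disjoint S T ∧ S.card = s ∧ T.card = t ∧
    ∀ x ∈ S, ∀ y ∈ T, ¬ G.Adj x y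

/-- The bipartite-hole-number of a graph: the minimum `k` such that, for some positive integers
`s` and `t` with `s + t = k + 1`, the graph contains no `(s, t)`-bipartite-hole. -/
noncomputable def bipartiteHoleNumber {V : Type*} (G : SimpleGraph V) : ℕ :=
  sInf {k : ℕ | ∃ s t : ℕ, 0 < s ∧ 0 < t ∧ s + t = k + 1 ∧ ¬ G.HasBipartiteHole s t}

/-- For a finite graph the set whose minimum defines the bipartite-hole-number is nonempty. -/
theorem bipartiteHoleNumber_set_nonempty {V : Type*} [Fintype V] (G : SimpleGraph V) :
    {k : ℕ | ∃ s t : ℕ, 0 < s ∧ 0 < t ∧ s + t = k + 1 ∧ ¬ G.HasBipartiteHole s t}.Nonempty := by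
  refine ⟨Fintype.card V + 1, 1, Fintype.card V + 1, by omega, by omega, by omega, ?_⟩
  rintro ⟨S, T, -, -, hT, -⟩
  have := T.card_le_univ
  omega

/-- A graph is traceable if it contains a Hamilton path. -/
def IsTraceable {V : Type*} [DecidableEq V] (G : SimpleGraph V) : Prop :=
  ∃ (u v : V) (p : G.Walk u v), p.IsHamiltonian

end SimpleGraph

/-! Fix positive `s`, `t` realizing the bipartite-hole-number: there is no `(s, t)`-hole, and every
degree is at least `s + t - 3`. By symmetry `s ≤ t`. Suppose a longest path `f 1, …, f m` misses a
vertex, let `K` be a component off the path, and let `Z` be the set of positions with a neighbor in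
`K`. Maximality makes the successors of `Z` together with `f 1` an independent set of `|Z| + 1`
vertices without edges to `K`. The same holds for the predecessors together with `f m`.

Holes come from one device: if `I` is independent without edges to `K`, any `s` vertices of `I` face
the rest of `I` and all of `K`. This gives `|K| + |Z| + 2 ≤ s + t` (`card_add_card_le`). The degree
of a vertex of `K` gives the reverse inequality, so equality holds, `K` is a clique, and `K` is
completely joined to the attachments (`component_structure`).

If `Z` is empty, the absence of holes forces `s = 1` and two cliques of equal order (`two_cliques`).
Otherwise `K` is a single vertex `c` (`card_component_le_one`), and further rearrangements show that
the path alternates between attachments and their successors (`two_mem_attachments`,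
`add_two_mem_attachments`). Then `c` and the successors form an independent set of `s + t - 1`
vertices. Any vertex outside it that is not an attachment would enlarge it and create a hole, so the
attachments are its whole complement, and the degree condition supplies every cross edge
(`independent_join`).

Conversely, a path cannot visit an independent set that exceeds its complement by two, and a
disconnected graph has no Hamilton path. -/

namespace SimpleGraph

/-! ### Longest paths and the components off them -/

variable {V : Type*}

/-- `l` lists the vertices of a walk of `G` from `x` to `y`. -/
def IsChainFromTo (G : SimpleGraph V) (l : List V) (x y : V) : Prop :=
  l.IsChain G.Adj ∧ l.head? = some x ∧ l.getLast? = some y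

namespace IsChainFromTo

variable {G : SimpleGraph V} {l l' : List V} {x y u v : V}

theorem singleton (x : V) : G.IsChainFromTo [x] x x := by
  simp [IsChainFromTo]

theorem append (h : G.IsChainFromTo l x y) (h' : G.IsChainFromTo l' u v) (hyu : G.Adj y u) :
    G.IsChainFromTo (l ++ l') x v := by
  obtain ⟨h1, h2, h3⟩ := h
  obtain ⟨h4, h5, h6⟩ := h'
  refine ⟨List.isChain_append.2 ⟨h1, h4, ?_⟩, by simp [h2], by simp [h6]⟩
  intro a ha b hb
  simp only [h3, h5, Option.mem_def, Option.some.injEq] at ha hb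
  subst ha hb
  exact hyu

theorem reverse (h : G.IsChainFromTo l x y) : G.IsChainFromTo l.reverse y x := by
  obtain ⟨h1, h2, h3⟩ := h
  refine ⟨?_, by simpa using h3, by simpa using h2⟩
  rw [List.isChain_reverse]
  simpa only [G.adj_comm] using h1

end IsChainFromTo

/-- The list `f a, f (a + 1), …, f b`. -/
def segment (f : ℕ → V) (a b : ℕ) : List V := (List.range' a (b + 1 - a)).map f

theorem mem_segment {f : ℕ → V} {a b : ℕ} {v : V} :
    v ∈ segment f a b ↔ ∃ i, a ≤ i ∧ i ≤ b ∧ f i = v := by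
  simp only [segment, List.mem_map, List.mem_range'_1]
  constructor
  · rintro ⟨i, hi, rfl⟩
    exact ⟨i, by omega, by omega, rfl⟩
  · rintro ⟨i, h1, h2, rfl⟩
    exact ⟨i, by omega, rfl⟩

theorem segment_append (f : ℕ → V) {a b c : ℕ} (hab : a ≤ b + 1) (hbc : b ≤ c) :
    segment f a b ++ segment f (b + 1) c = segment f a c := by
  simp only [segment, ← List.map_append]
  congr 1
  obtain ⟨k, rfl⟩ := Nat.exists_eq_add_of_le hbc
  obtain ⟨j, hj⟩ := Nat.exists_eq_add_of_le hab
  have e1 : b + 1 - a = j := by omega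
  have e2 : b + k + 1 - a = j + k := by omega
  have e3 : b + k + 1 - (b + 1) = k := by omega
  rw [e1, e2, e3, hj, List.range'_append_1]

theorem segment_eq_nil (f : ℕ → V) {a b : ℕ} (h : b < a) : segment f a b = [] := by
  have : b + 1 - a = 0 := by omega
  simp [segment, this]

theorem length_segment (f : ℕ → V) (a b : ℕ) : (segment f a b).length = b + 1 - a := by
  simp [segment]

/-- `f 1, …, f m` is a longest path of `G`. -/
structure IsLongestPath (G : SimpleGraph V) (m : ℕ) (f : ℕ → V) : Prop where
  inj : ∀ i j, 1 ≤ i → i ≤ m → 1 ≤ j → j ≤ m → f i = f j → i = j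
  adj : ∀ i, 1 ≤ i → i < m → G.Adj (f i) (f (i + 1))
  length_le : ∀ l : List V, l.IsChain G.Adj → l.Nodup → l.length ≤ m

/-- A finite graph has a longest path. -/
theorem exists_isLongestPath [Finite V] [Nonempty V] (G : SimpleGraph V) :
    ∃ m f, G.IsLongestPath m f := by
  classical
  have := Fintype.ofFinite V
  let P : ℕ → Prop := fun k => ∃ l : List V, l.IsChain G.Adj ∧ l.Nodup ∧ l.length = k
  have hb : ∀ k, P k → k ≤ Fintype.card V := by
    rintro k ⟨l, -, hl, rfl⟩
    exact hl.length_le_card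
  have h0 : P 0 := ⟨[], by simp, by simp, rfl⟩
  obtain ⟨l, hc, hn, hl⟩ := Nat.findGreatest_spec (P := P) (Nat.zero_le (Fintype.card V)) h0
  set m := Nat.findGreatest P (Fintype.card V) with hm
  obtain ⟨v₀⟩ := ‹Nonempty V›
  -- Positions are shifted to start at 1, which leaves 0 and `m + 1` free as virtual positions
  -- beyond the ends. The default `v₀` is never read on `1, …, m`.
  refine ⟨m, fun i => l.getD (i - 1) v₀, ?_, ?_, ?_⟩
  · intro i j h1 h2 h3 h4 h
    have hi : i - 1 < l.length := by omega
    have hj : j - 1 < l.length := by omega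
    simp only [List.getD_eq_getElem _ _ hi, List.getD_eq_getElem _ _ hj] at h
    have := (hn.getElem_inj_iff).1 h
    omega
  · intro i h1 h2
    obtain ⟨i, rfl⟩ := Nat.exists_eq_add_of_le' h1
    have hi : i + 1 < l.length := by omega
    simp only [Nat.add_sub_cancel]
    rw [List.getD_eq_getElem _ _ hi, List.getD_eq_getElem _ _ (Nat.lt_of_succ_lt hi)]
    exact List.isChain_iff_getElem.1 hc i hi
  · intro l' hc' hn'
    exact Nat.le_findGreatest (hb _ ⟨l', hc', hn', rfl⟩) ⟨l', hc', hn', rfl⟩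

namespace IsLongestPath

variable {G : SimpleGraph V} {m : ℕ} {f : ℕ → V}

theorem isChainFromTo_segment (h : G.IsLongestPath m f) {a b : ℕ} (ha : 1 ≤ a) (hab : a ≤ b)
    (hb : b ≤ m) : G.IsChainFromTo (segment f a b) (f a) (f b) := by
  induction b, hab using Nat.le_induction with
  | base =>
    have : a + 1 - a = 1 := by omega
    simp [segment, this, IsChainFromTo]
  | succ b hab ih =>
    rw [← segment_append f (by omega : a ≤ b + 1) (Nat.le_succ b)]
    refine (ih (by omega)).append (x := f a) (u := f (b + 1)) ?_ (h.adj b (by omega) (by omega))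
    have : b + 1 + 1 - (b + 1) = 1 := by omega
    simp [segment, this, IsChainFromTo]

theorem nodup_segment (h : G.IsLongestPath m f) : (segment f 1 m).Nodup := by
  refine List.Nodup.map_on ?_ List.nodup_range'
  intro i hi j hj hij
  simp only [List.mem_range'_1] at hi hj
  exact h.inj i j (by omega) (by omega) (by omega) (by omega) hij

/-- A walk with end vertices attached to an initial and a final segment of the path. -/
theorem isChain_sandwich (h : G.IsLongestPath m f) {l : List V} {u v : V} {a b : ℕ}
    (hl : G.IsChainFromTo l u v) (ha : a = 0 ∨ (1 ≤ a ∧ a ≤ m ∧ G.Adj (f a) u))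
    (hb : b = m + 1 ∨ (1 ≤ b ∧ b ≤ m ∧ G.Adj v (f b))) :
    (segment f 1 a ++ (l ++ segment f b m)).IsChain G.Adj := by
  have key : ∃ w, G.IsChainFromTo (l ++ segment f b m) u w := by
    rcases hb with rfl | ⟨h1, h2, h3⟩
    · exact ⟨v, by simpa [segment_eq_nil f (Nat.lt_succ_self m)] using hl⟩
    · exact ⟨f m, hl.append (h.isChainFromTo_segment h1 h2 le_rfl) h3⟩
  obtain ⟨w, hw⟩ := key
  rcases ha with rfl | ⟨h1, h2, h3⟩
  · simpa [segment_eq_nil f zero_lt_one] using hw.1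
  · exact ((h.isChainFromTo_segment le_rfl h1 h2).append hw h3).1

/-- No path uses vertices outside the longest path and misses fewer of its vertices. -/
theorem false_of_isChain (h : G.IsLongestPath m f) {l k : List V} {r : Multiset V}
    (hk : k.Nodup) (hoff : ∀ v ∈ k, ∀ i, 1 ≤ i → i ≤ m → f i ≠ v) (hl : l.IsChain G.Adj)
    (heq : (l : Multiset V) + r = (segment f 1 m : Multiset V) + (k : Multiset V))
    (hr : r.card < k.length) : False := by
  have hn : (segment f 1 m ++ k).Nodup := by
    refine List.nodup_append'.2 ⟨h.nodup_segment, hk, ?_⟩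
    intro v hv hvk
    obtain ⟨i, h1, h2, rfl⟩ := mem_segment.1 hv
    exact hoff _ hvk i h1 h2 rfl
  have hnl : l.Nodup := by
    rw [← Multiset.coe_nodup]
    refine Multiset.nodup_of_le (Multiset.le_add_right _ r) ?_
    rw [heq]
    simpa using hn
  have h1 := h.length_le l hl hnl
  have h2 := congrArg Multiset.card heq
  simp only [Multiset.card_add, Multiset.coe_card, length_segment] at h2
  omega

end IsLongestPath

/-- `K` is a set of vertices off the path `f 1, …, f m`, any two of which are joined by a path
off that path, and which is closed under taking neighbors off that path. -/
structure IsOffPathComponent (G : SimpleGraph V) (m : ℕ) (f : ℕ → V) (K : Finset V) : Prop where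
  nonempty : K.Nonempty
  off : ∀ v ∈ K, ∀ i, 1 ≤ i → i ≤ m → f i ≠ v
  closed : ∀ v ∈ K, ∀ u, G.Adj v u → u ∈ K ∨ ∃ i, 1 ≤ i ∧ i ≤ m ∧ f i = u
  link : ∀ a ∈ K, ∀ b ∈ K, ∃ l, G.IsChainFromTo l a b ∧ l.Nodup ∧
    ∀ v ∈ l, ∀ i, 1 ≤ i → i ≤ m → f i ≠ v

theorem exists_isOffPathComponent [Finite V] (G : SimpleGraph V) {m : ℕ} {f : ℕ → V} {c : V}
    (hc : ∀ i, 1 ≤ i → i ≤ m → f i ≠ c) : ∃ K, c ∈ K ∧ G.IsOffPathComponent m f K := by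
  classical
  have := Fintype.ofFinite V
  let Q : V → Prop := fun v => ∀ i, 1 ≤ i → i ≤ m → f i ≠ v
  refine ⟨Finset.univ.filter fun v => ∃ p : G.Walk c v, ∀ x ∈ p.support, Q x, ?_, ?_⟩
  · simp only [Finset.mem_filter, Finset.mem_univ, true_and]
    exact ⟨.nil, by simpa using hc⟩
  constructor
  · refine ⟨c, ?_⟩
    simp only [Finset.mem_filter, Finset.mem_univ, true_and]
    exact ⟨.nil, by simpa using hc⟩
  · intro v hv
    obtain ⟨p, hp⟩ := (Finset.mem_filter.1 hv).2
    exact hp v p.end_mem_support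
  · intro v hv u hvu
    obtain ⟨p, hp⟩ := (Finset.mem_filter.1 hv).2
    by_cases hu : Q u
    · left
      simp only [Finset.mem_filter, Finset.mem_univ, true_and]
      refine ⟨p.concat hvu, ?_⟩
      intro x hx
      rw [Walk.support_concat, List.mem_append, List.mem_singleton] at hx
      rcases hx with hx | rfl
      · exact hp x hx
      · exact hu
    · right
      simp only [Q, not_forall, not_not] at hu
      obtain ⟨i, h1, h2, h3⟩ := hu
      exact ⟨i, h1, h2, h3⟩
  · intro a ha b hb
    obtain ⟨p, hp⟩ := (Finset.mem_filter.1 ha).2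
    obtain ⟨q, hq⟩ := (Finset.mem_filter.1 hb).2
    -- The walk through `c` may repeat vertices; `bypass` removes repetitions and adds no vertex, so
    -- the result stays off the path.
    let w := (p.reverse.append q).bypass
    refine ⟨w.support, ⟨w.isChain_adj_support, ?_, ?_⟩, (Walk.bypass_isPath _).support_nodup, ?_⟩
    · rw [List.head?_eq_some_head w.support_ne_nil, w.head_support]
    · rw [List.getLast?_eq_some_getLast w.support_ne_nil, w.getLast_support]
    · intro v hv
      have := Walk.support_bypass_subset_support _ hv
      rw [Walk.mem_support_append_iff, Walk.support_reverse, List.mem_reverse] at this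
      rcases this with h | h
      · exact hp v h
      · exact hq v h

end SimpleGraph

/-! ### Rearrangements of a longest path -/

namespace SimpleGraph

variable {V : Type*}

open Classical in
/-- The positions of the vertices of the path `f 1, …, f m` that have a neighbor in `K`. -/
noncomputable def attachments (G : SimpleGraph V) (m : ℕ) (f : ℕ → V) (K : Finset V) : Finset ℕ :=
  (Finset.Icc 1 m).filter fun i => ∃ c ∈ K, G.Adj (f i) c

variable {G : SimpleGraph V} {m : ℕ} {f : ℕ → V} {K : Finset V}

theorem mem_attachments {i : ℕ} :
    i ∈ G.attachments m f K ↔ 1 ≤ i ∧ i ≤ m ∧ ∃ c ∈ K, G.Adj (f i) c := by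
  simp [attachments, and_assoc]

namespace IsLongestPath

/-- If a longest path, extended by a path off it, is rearranged, the result is not a path. -/
theorem false_of_sandwich (h : G.IsLongestPath m f) {l k : List V} {u v c d : V} {a b : ℕ}
    (hk : G.IsChainFromTo k c d) (hn : k.Nodup)
    (hoff : ∀ v ∈ k, ∀ i, 1 ≤ i → i ≤ m → f i ≠ v)
    (hl : G.IsChainFromTo l u v) (ha : a = 0 ∨ (1 ≤ a ∧ a ≤ m ∧ G.Adj (f a) u))
    (hb : b + 1 = m + 1 ∨ (1 ≤ b + 1 ∧ b + 1 ≤ m ∧ G.Adj v (f (b + 1)))) (hab : a ≤ b)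
    (heq : (l : Multiset V) = (segment f (a + 1) b : Multiset V) + (k : Multiset V)) : False := by
  refine h.false_of_isChain (r := 0) hn hoff (h.isChain_sandwich hl ha hb) ?_ ?_
  · rw [← segment_append f (by omega : 1 ≤ a + 1) (by omega : a ≤ m),
      ← segment_append f (by omega : a + 1 ≤ b + 1) (by omega : b ≤ m)]
    simp only [← Multiset.coe_add, heq]
    abel
  · rw [Multiset.card_zero, List.length_pos_iff]
    rintro rfl
    simpa using hk.2.1

variable (h : G.IsLongestPath m f) (hK : G.IsOffPathComponent m f K)
include h hK

theorem one_notMem_attachments : 1 ∉ G.attachments m f K := by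
  intro h1
  obtain ⟨-, hm, c, hc, hac⟩ := mem_attachments.1 h1
  obtain ⟨l, hl, hn, ho⟩ := hK.link c hc c hc
  exact h.false_of_sandwich (a := 0) (b := 0) hl hn ho hl (Or.inl rfl)
    (Or.inr ⟨le_rfl, hm, hac.symm⟩) le_rfl (by simp [segment])

theorem last_notMem_attachments : m ∉ G.attachments m f K := by
  intro h1
  obtain ⟨hm, -, c, hc, hac⟩ := mem_attachments.1 h1
  obtain ⟨l, hl, hn, ho⟩ := hK.link c hc c hc
  exact h.false_of_sandwich (a := m) (b := m) hl hn ho hl (Or.inr ⟨hm, le_rfl, hac⟩)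
    (Or.inl rfl) le_rfl (by simp [segment])

theorem succ_notMem_attachments {a : ℕ} (ha : a ∈ G.attachments m f K) :
    a + 1 ∉ G.attachments m f K := by
  intro hb
  obtain ⟨ha1, ham, c, hc, hac⟩ := mem_attachments.1 ha
  obtain ⟨hb1, hbm, d, hd, hbd⟩ := mem_attachments.1 hb
  obtain ⟨l, hl, hn, ho⟩ := hK.link c hc d hd
  exact h.false_of_sandwich (a := a) (b := a) hl hn ho hl (Or.inr ⟨ha1, ham, hac⟩)
    (Or.inr ⟨hb1, hbm, hbd.symm⟩) le_rfl (by simp [segment])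

/-- Such an edge would give the longer path `f 1 … f a`, through `K`, back along `f b … f (a + 1)`,
then `f (b + 1) … f m`. For `a = 0` it starts in `K`. -/
theorem not_adj_succ_succ {a b : ℕ} (ha : a = 0 ∨ a ∈ G.attachments m f K)
    (hb : b ∈ G.attachments m f K) (hab : a < b) : ¬ G.Adj (f (a + 1)) (f (b + 1)) := by
  intro hadj
  obtain ⟨hb1, hbm, d, hd, hbd⟩ := mem_attachments.1 hb
  have hbm' : b ≠ m := fun h' => h.last_notMem_attachments hK (h' ▸ hb)
  obtain ⟨c, hc, ha'⟩ : ∃ c ∈ K, a = 0 ∨ (1 ≤ a ∧ a ≤ m ∧ G.Adj (f a) c) := by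
    rcases ha with rfl | ha
    · exact ⟨d, hd, Or.inl rfl⟩
    · obtain ⟨h1, h2, c, hc, hac⟩ := mem_attachments.1 ha
      exact ⟨c, hc, Or.inr ⟨h1, h2, hac⟩⟩
  obtain ⟨l, hl, hn, ho⟩ := hK.link c hc d hd
  refine h.false_of_sandwich (a := a) (b := b) hl hn ho
    (hl.append (h.isChainFromTo_segment (a := a + 1) (b := b) (by omega) hab hbm).reverse
      hbd.symm) ha' (Or.inr ⟨by omega, by omega, hadj⟩) hab.le ?_
  simp only [← Multiset.coe_add, Multiset.coe_reverse]
  abel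

/-- The longer path would be `f 1 … f (a - 1)`, back along `f (b - 1) … f a`, through `K`, then `f b
… f m`. For `b = m + 1` it ends in `K`. -/
theorem not_adj_pred_pred {a b : ℕ} (ha : a ∈ G.attachments m f K)
    (hb : b = m + 1 ∨ b ∈ G.attachments m f K) (hab : a < b) :
    ¬ G.Adj (f (a - 1)) (f (b - 1)) := by
  intro hadj
  obtain ⟨ha1, ham, c, hc, hac⟩ := mem_attachments.1 ha
  have ha1' : a ≠ 1 := fun h' => h.one_notMem_attachments hK (h' ▸ ha)
  obtain ⟨a, rfl⟩ := Nat.exists_eq_add_of_le' ha1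
  obtain ⟨b, rfl⟩ := Nat.exists_eq_add_of_le' (by omega : 1 ≤ b)
  simp only [Nat.add_sub_cancel] at hadj
  obtain ⟨d, hd, hb', hbm⟩ : ∃ d ∈ K, (b + 1 = m + 1 ∨
      (1 ≤ b + 1 ∧ b + 1 ≤ m ∧ G.Adj d (f (b + 1)))) ∧ b ≤ m := by
    rcases hb with hb | hb
    · exact ⟨c, hc, Or.inl hb, by omega⟩
    · obtain ⟨h1, h2, d, hd, hbd⟩ := mem_attachments.1 hb
      exact ⟨d, hd, Or.inr ⟨h1, h2, hbd.symm⟩, by omega⟩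
  obtain ⟨l, hl, hn, ho⟩ := hK.link c hc d hd
  refine h.false_of_sandwich (a := a) (b := b) hl hn ho
    ((h.isChainFromTo_segment (a := a + 1) (b := b) (by omega) (by omega) hbm).reverse.append
      hl hac) (Or.inr ⟨by omega, by omega, hadj⟩) hb' (by omega) ?_
  simp only [← Multiset.coe_add, Multiset.coe_reverse]

/-- The longer path would be `f (a + 1) … f (b - 1)`, then `f 1 … f a`, through `K`, then `f b … f
m`. -/
theorem not_adj_first_pred {a b : ℕ} (ha : a ∈ G.attachments m f K)
    (hb : b = m + 1 ∨ b ∈ G.attachments m f K) (hab : a < b) :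
    ¬ G.Adj (f 1) (f (b - 1)) := by
  intro hadj
  obtain ⟨ha1, ham, c, hc, hac⟩ := mem_attachments.1 ha
  have ham' : a ≠ m := fun h' => h.last_notMem_attachments hK (h' ▸ ha)
  have hba : b ≠ a + 1 := by
    rintro rfl
    rcases hb with hb | hb
    · omega
    · exact h.succ_notMem_attachments hK ha hb
  obtain ⟨b, rfl⟩ := Nat.exists_eq_add_of_le' (by omega : 1 ≤ b)
  simp only [Nat.add_sub_cancel] at hadj
  obtain ⟨d, hd, hb', hbm⟩ : ∃ d ∈ K, (b + 1 = m + 1 ∨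
      (1 ≤ b + 1 ∧ b + 1 ≤ m ∧ G.Adj d (f (b + 1)))) ∧ b ≤ m := by
    rcases hb with hb | hb
    · exact ⟨c, hc, Or.inl hb, by omega⟩
    · obtain ⟨h1, h2, d, hd, hbd⟩ := mem_attachments.1 hb
      exact ⟨d, hd, Or.inr ⟨h1, h2, hbd.symm⟩, by omega⟩
  obtain ⟨l, hl, hn, ho⟩ := hK.link c hc d hd
  refine h.false_of_sandwich (a := 0) (b := b) hl hn ho
    ((h.isChainFromTo_segment (a := a + 1) (b := b) (by omega) (by omega) hbm).append
      ((h.isChainFromTo_segment (a := 1) (b := a) le_rfl ha1 ham).append hl hac) hadj.symm)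
    (Or.inl rfl) hb' (by omega) ?_
  rw [zero_add, ← segment_append f (by omega : 1 ≤ a + 1) (by omega : a ≤ b)]
  simp only [← Multiset.coe_add]
  abel

/-- The rearrangement that uses two edges crossing between the attachments of one vertex. -/
theorem not_adj_and_adj {c : V} (hc : c ∈ K) (hKc : ∀ x ∈ K, x = c) {a b i : ℕ}
    (ha : a = 0 ∨ a ∈ G.attachments m f K) (hb : b ∈ G.attachments m f K)
    (hi : i ∈ G.attachments m f K) (hab : a < b) (hbi : b ≤ i) :
    ¬ (G.Adj (f (a + 1)) (f i) ∧ G.Adj (f (i + 1)) (f (b - 1))) := by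
  rintro ⟨hadj1, hadj2⟩
  have key : ∀ j ∈ G.attachments m f K, G.Adj (f j) c := by
    intro j hj
    obtain ⟨-, -, d, hd, hjd⟩ := mem_attachments.1 hj
    exact hKc d hd ▸ hjd
  obtain ⟨hb1, hbm, -⟩ := mem_attachments.1 hb
  obtain ⟨hi1, him, -⟩ := mem_attachments.1 hi
  have him' : i ≠ m := fun h' => h.last_notMem_attachments hK (h' ▸ hi)
  have hba : b ≠ a + 1 := by
    rintro rfl
    rcases ha with rfl | ha
    · exact h.one_notMem_attachments hK hb
    · exact h.succ_notMem_attachments hK ha hb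
  have ha' : a = 0 ∨ (1 ≤ a ∧ a ≤ m ∧ G.Adj (f a) c) := by
    rcases ha with rfl | ha
    · exact Or.inl rfl
    · obtain ⟨h1, h2, -⟩ := mem_attachments.1 ha
      exact Or.inr ⟨h1, h2, key a ha⟩
  obtain ⟨b, rfl⟩ := Nat.exists_eq_add_of_le' hb1
  simp only [Nat.add_sub_cancel] at hadj2
  -- After the shift of `b`, the new path is `f 1 … f a`, `c`, `f (b + 1) … f i`, `f (a + 1) … f b`,
  -- `f (i + 1) … f m`.
  refine h.false_of_sandwich (a := a) (b := i) (k := [c]) (IsChainFromTo.singleton c)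
    (List.nodup_singleton c) (fun v hv => hK.off v (by simpa [List.mem_singleton.1 hv] using hc))
    ((IsChainFromTo.singleton c).append
      ((h.isChainFromTo_segment (a := b + 1) (b := i) (by omega) hbi him).append
        (h.isChainFromTo_segment (a := a + 1) (b := b) (by omega) (by omega) (by omega))
        hadj1.symm) (key _ hb).symm)
    ha' (Or.inr ⟨by omega, by omega, hadj2.symm⟩) (by omega) ?_
  rw [← segment_append f (by omega : a + 1 ≤ b + 1) (by omega : b ≤ i)]
  simp only [← Multiset.coe_add]
  abel

/-- An attached clique is at most as long as the parts of the path before and after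
an attachment. -/
theorem card_lt_of_clique (hcl : ∀ x ∈ K, ∀ y ∈ K, x ≠ y → G.Adj x y)
    (hfull : ∀ i ∈ G.attachments m f K, ∀ c ∈ K, G.Adj (f i) c) {z : ℕ}
    (hz : z ∈ G.attachments m f K) : K.card + 1 ≤ z ∧ z + K.card ≤ m := by
  obtain ⟨hz1, hzm, -⟩ := mem_attachments.1 hz
  have hne : K.toList ≠ [] := by simpa using hK.nonempty.ne_empty
  have hchain : G.IsChainFromTo K.toList (K.toList.head hne) (K.toList.getLast hne) := by
    refine ⟨?_, List.head?_eq_some_head hne, List.getLast?_eq_some_getLast hne⟩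
    refine List.Pairwise.isChain (K.nodup_toList.imp_of_mem ?_)
    intro a b ha hb hab
    exact hcl a (Finset.mem_toList.1 ha) b (Finset.mem_toList.1 hb) hab
  have hoff : ∀ v ∈ K.toList, ∀ i, 1 ≤ i → i ≤ m → f i ≠ v :=
    fun v hv => hK.off v (Finset.mem_toList.1 hv)
  constructor
  · by_contra hlt
    -- Replacing the part before `z` by all of the clique `K` must not lengthen the path.
    refine h.false_of_isChain (r := (segment f 1 (z - 1) : Multiset V)) K.nodup_toList hoff
      (h.isChain_sandwich (a := 0) hchain (Or.inl rfl) (b := z)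
        (Or.inr ⟨hz1, hzm, (hfull z hz _ (Finset.mem_toList.1 (List.getLast_mem hne))).symm⟩)) ?_ ?_
    · obtain ⟨z, rfl⟩ := Nat.exists_eq_add_of_le' hz1
      rw [segment_eq_nil f zero_lt_one, Nat.add_sub_cancel,
        ← segment_append f (by omega : 1 ≤ z + 1) (by omega : z ≤ m)]
      simp only [← Multiset.coe_add, Multiset.coe_nil]
      abel
    · simp only [Multiset.coe_card, length_segment, Finset.length_toList]
      omega
  · by_contra hlt
    refine h.false_of_isChain (r := (segment f (z + 1) m : Multiset V)) K.nodup_toList hoff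
      (h.isChain_sandwich (a := z) hchain
        (Or.inr ⟨hz1, hzm, (hfull z hz _ (Finset.mem_toList.1 (List.head_mem hne)))⟩)
        (b := m + 1) (Or.inl rfl)) ?_ ?_
    · rw [segment_eq_nil f (Nat.lt_succ_self m),
        ← segment_append f (by omega : 1 ≤ z + 1) (by omega : z ≤ m)]
      simp only [← Multiset.coe_add, Multiset.coe_nil]
      abel
    · simp only [Multiset.coe_card, length_segment, Finset.length_toList]
      omega

/-- A vertex off the path and off `K` is not adjacent to a successor of an attachment that is
followed by another attachment. -/
theorem not_adj_succ_of_off {c x : V} (hc : c ∈ K) (hKc : ∀ x ∈ K, x = c) (hx : x ≠ c)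
    (hxoff : ∀ i, 1 ≤ i → i ≤ m → f i ≠ x) {i : ℕ} (h2 : 2 ∈ G.attachments m f K)
    (hi : i ∈ G.attachments m f K) (hi2 : i + 2 = m + 1 ∨ i + 2 ∈ G.attachments m f K) :
    ¬ G.Adj x (f (i + 1)) := by
  intro hadj
  have key : ∀ j ∈ G.attachments m f K, G.Adj (f j) c := by
    intro j hj
    obtain ⟨-, -, d, hd, hjd⟩ := mem_attachments.1 hj
    exact hKc d hd ▸ hjd
  obtain ⟨hi1, him, -⟩ := mem_attachments.1 hi
  have hi1' : i ≠ 1 := fun h' => h.one_notMem_attachments hK (h' ▸ hi)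
  have him' : i ≠ m := fun h' => h.last_notMem_attachments hK (h' ▸ hi)
  have hb : i + 2 = m + 1 ∨ (1 ≤ i + 2 ∧ i + 2 ≤ m ∧ G.Adj c (f (i + 2))) := by
    rcases hi2 with h' | h'
    · exact Or.inl h'
    · obtain ⟨h1, h2, -⟩ := mem_attachments.1 h'
      exact Or.inr ⟨h1, h2, (key _ h').symm⟩
  -- The path `x`, `f (i + 1) … f 2`, `c`, `f (i + 2) … f m` loses only `f 1` and gains both `x` and
  -- `c`.
  have hch := (IsChainFromTo.singleton x (G := G)).append
    ((h.isChainFromTo_segment (a := 2) (b := i + 1) (by omega) (by omega) (by omega)).reverse.append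
      (IsChainFromTo.singleton c) (key 2 h2)) hadj
  refine h.false_of_isChain (k := [x, c]) (r := {f 1}) (by simpa using hx) ?_
    (h.isChain_sandwich (a := 0) hch (Or.inl rfl) hb) ?_ (by simp)
  · intro v hv
    simp only [List.mem_cons, List.not_mem_nil, or_false] at hv
    rcases hv with rfl | rfl
    · exact hxoff
    · exact hK.off _ hc
  · have e1 : segment f 1 1 = [f 1] := by simp [segment]
    have e2 : [x, c] = [x] ++ [c] := rfl
    rw [segment_eq_nil f zero_lt_one,
      ← segment_append f (by omega : 1 ≤ (i + 1) + 1) (by omega : i + 1 ≤ m),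
      ← segment_append f (by omega : 1 ≤ 1 + 1) (by omega : 1 ≤ i + 1), e1, e2]
    simp only [← Multiset.coe_add, Multiset.coe_reverse, Multiset.coe_nil, Multiset.coe_singleton]
    abel

end IsLongestPath

end SimpleGraph

/-! ### Holes from independent sets; successors and predecessors of attachments -/

namespace SimpleGraph

variable {V : Type*} {G : SimpleGraph V} {s t : ℕ}

theorem hasBipartiteHole_of_le {S T : Finset V} (hS : s ≤ S.card) (hT : t ≤ T.card)
    (hd : Disjoint S T) (hST : ∀ x ∈ S, ∀ y ∈ T, ¬ G.Adj x y) : G.HasBipartiteHole s t := by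
  obtain ⟨S', hS', hs⟩ := Finset.exists_subset_card_eq hS
  obtain ⟨T', hT', ht⟩ := Finset.exists_subset_card_eq hT
  exact ⟨S', T', Finset.disjoint_of_subset_left hS' (Finset.disjoint_of_subset_right hT' hd),
    hs, ht, fun x hx y hy => hST x (hS' hx) y (hT' hy)⟩

theorem HasBipartiteHole.symm (h : G.HasBipartiteHole s t) : G.HasBipartiteHole t s := by
  obtain ⟨S, T, hd, hS, hT, hST⟩ := h
  exact ⟨T, S, hd.symm, hT, hS, fun x hx y hy hxy => hST y hy x hx hxy.symm⟩

/-- An independent set and a set without edges to it form a bipartite hole. -/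
theorem hasBipartiteHole_of_independent [DecidableEq V] {I W K : Finset V} (hW : W ⊆ I)
    (hI : ∀ x ∈ I, ∀ y ∈ I, ¬ G.Adj x y) (hIK : ∀ x ∈ I, x ∉ K)
    (hWK : ∀ x ∈ W, ∀ y ∈ K, ¬ G.Adj x y) (hs : s ≤ W.card)
    (hst : s + t ≤ I.card + K.card) : G.HasBipartiteHole s t := by
  obtain ⟨S, hSW, hS⟩ := Finset.exists_subset_card_eq hs
  have hSI := hSW.trans hW
  have hd : Disjoint (I \ S) K := by
    rw [Finset.disjoint_left]
    exact fun x hx => hIK x (Finset.mem_sdiff.1 hx).1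
  refine hasBipartiteHole_of_le (S := S) (T := (I \ S) ∪ K) hS.ge ?_ ?_ ?_
  · rw [Finset.card_union_of_disjoint hd, Finset.card_sdiff_of_subset hSI]
    omega
  · rw [Finset.disjoint_left]
    intro x hx hx'
    rcases Finset.mem_union.1 hx' with h | h
    · exact (Finset.mem_sdiff.1 h).2 hx
    · exact hIK x (hSI hx) h
  · intro x hx y hy
    rcases Finset.mem_union.1 hy with h | h
    · exact hI x (hSI hx) y (Finset.mem_sdiff.1 h).1
    · exact hWK x (hSW hx) y h

/-- The vertex `x` is put on the side of `K`. The other side is chosen inside `W`, so edges from `x`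
to `K` or to the rest of `I` do no harm. -/
theorem hasBipartiteHole_of_independent_of_notMem [DecidableEq V] {I W K : Finset V} {x : V}
    (hW : W ⊆ I) (hI : ∀ x ∈ I, ∀ y ∈ I, ¬ G.Adj x y) (hIK : ∀ x ∈ I, x ∉ K)
    (hWK : ∀ x ∈ W, ∀ y ∈ K, ¬ G.Adj x y) (hxI : x ∉ I) (hxK : x ∉ K)
    (hxW : ∀ y ∈ W, ¬ G.Adj x y) (hs : s ≤ W.card)
    (hst : s + t ≤ I.card + K.card + 1) : G.HasBipartiteHole s t := by
  refine hasBipartiteHole_of_independent (K := insert x K) hW hI ?_ ?_ hs ?_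
  · intro y hy h
    rcases Finset.mem_insert.1 h with rfl | h
    · exact hxI hy
    · exact hIK y hy h
  · intro y hy z hz h
    rcases Finset.mem_insert.1 hz with rfl | hz
    · exact hxW y hy h.symm
    · exact hWK y hy z hz h
  · rw [Finset.card_insert_of_notMem hxK]
    omega

section Counting

variable {m : ℕ} {f : ℕ → V} {K : Finset V}

open Classical in
/-- The successors of the attachments of `K`, together with the first vertex of the path. -/
noncomputable def successors (G : SimpleGraph V) (m : ℕ) (f : ℕ → V) (K : Finset V) : Finset V :=
  (insert 0 (G.attachments m f K)).image fun a => f (a + 1)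

open Classical in
/-- The predecessors of the attachments of `K`, together with the last vertex of the path. -/
noncomputable def predecessors (G : SimpleGraph V) (m : ℕ) (f : ℕ → V) (K : Finset V) :
    Finset V :=
  (insert (m + 1) (G.attachments m f K)).image fun a => f (a - 1)

theorem not_adj_of_notMem_attachments {i : ℕ} (hi1 : 1 ≤ i) (him : i ≤ m)
    (hi : i ∉ G.attachments m f K) : ∀ c ∈ K, ¬ G.Adj (f i) c :=
  fun c hc hic => hi (mem_attachments.2 ⟨hi1, him, c, hc, hic⟩)

namespace IsLongestPath

variable (h : G.IsLongestPath m f) (hK : G.IsOffPathComponent m f K)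
include h hK

theorem one_lt_of_mem {a : ℕ} (ha : a ∈ G.attachments m f K) : 1 < a ∧ a < m := by
  obtain ⟨h1, h2, -⟩ := mem_attachments.1 ha
  have h3 : a ≠ 1 := fun h' => h.one_notMem_attachments hK (h' ▸ ha)
  have h4 : a ≠ m := fun h' => h.last_notMem_attachments hK (h' ▸ ha)
  omega

theorem one_le : 1 ≤ m := by
  obtain ⟨v, -⟩ := hK.nonempty
  exact h.length_le [v] (by simp) (by simp)

theorem card_image_succ {Z : Finset ℕ} (hZ : ∀ a ∈ Z, a = 0 ∨ a ∈ G.attachments m f K)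
    [DecidableEq V] : (Z.image fun a => f (a + 1)).card = Z.card := by
  refine Finset.card_image_of_injOn ?_
  have key : ∀ a ∈ Z, a + 1 ≤ m := by
    intro a ha
    rcases hZ a ha with rfl | ha
    · exact h.one_le hK
    · exact (h.one_lt_of_mem hK ha).2
  intro a ha b hb hab
  have := h.inj (a + 1) (b + 1) (by omega) (key a ha) (by omega) (key b hb) hab
  omega

theorem card_image_pred {Z : Finset ℕ} (hZ : ∀ a ∈ Z, a = m + 1 ∨ a ∈ G.attachments m f K)
    [DecidableEq V] : (Z.image fun a => f (a - 1)).card = Z.card := by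
  refine Finset.card_image_of_injOn ?_
  have key : ∀ a ∈ Z, 1 < a ∧ a ≤ m + 1 := by
    intro a ha
    rcases hZ a ha with rfl | ha
    · exact ⟨by have := h.one_le hK; omega, le_rfl⟩
    · have := h.one_lt_of_mem hK ha
      omega
  intro a ha b hb hab
  have h1 := key a ha
  have h2 := key b hb
  have := h.inj (a - 1) (b - 1) (by omega) (by omega) (by omega) (by omega) hab
  omega

theorem card_image_attachments [DecidableEq V] :
    ((G.attachments m f K).image f).card = (G.attachments m f K).card := by
  refine Finset.card_image_of_injOn ?_
  intro a ha b hb hab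
  have h1 := h.one_lt_of_mem hK ha
  have h2 := h.one_lt_of_mem hK hb
  exact h.inj a b (by omega) (by omega) (by omega) (by omega) hab

theorem card_successors : (G.successors m f K).card = (G.attachments m f K).card + 1 := by
  classical
  rw [successors, h.card_image_succ hK, Finset.card_insert_of_notMem]
  · intro h0
    have := h.one_lt_of_mem hK h0
    omega
  · intro a ha
    simpa using ha

theorem card_predecessors : (G.predecessors m f K).card = (G.attachments m f K).card + 1 := by
  classical
  rw [predecessors, h.card_image_pred hK, Finset.card_insert_of_notMem]
  · intro h0
    have := h.one_lt_of_mem hK h0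
    omega
  · intro a ha
    simpa using ha

theorem mem_successors {v : V} : v ∈ G.successors m f K ↔
    ∃ a, (a = 0 ∨ a ∈ G.attachments m f K) ∧ a < m ∧ f (a + 1) = v := by
  classical
  simp only [successors, Finset.mem_image, Finset.mem_insert]
  constructor
  · rintro ⟨a, ha, rfl⟩
    refine ⟨a, ha, ?_, rfl⟩
    rcases ha with rfl | ha
    · exact h.one_le hK
    · exact (h.one_lt_of_mem hK ha).2
  · rintro ⟨a, ha, -, rfl⟩
    exact ⟨a, ha, rfl⟩

theorem mem_predecessors {v : V} : v ∈ G.predecessors m f K ↔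
    ∃ a, (a = m + 1 ∨ a ∈ G.attachments m f K) ∧ 1 < a ∧ a ≤ m + 1 ∧ f (a - 1) = v := by
  classical
  simp only [predecessors, Finset.mem_image, Finset.mem_insert]
  constructor
  · rintro ⟨a, ha, rfl⟩
    refine ⟨a, ha, ?_⟩
    rcases ha with rfl | ha
    · have := h.one_le hK
      exact ⟨by omega, by omega, rfl⟩
    · have := h.one_lt_of_mem hK ha
      exact ⟨by omega, by omega, rfl⟩
  · rintro ⟨a, ha, -, -, rfl⟩
    exact ⟨a, ha, rfl⟩

theorem successors_independent :
    ∀ x ∈ G.successors m f K, ∀ y ∈ G.successors m f K, ¬ G.Adj x y := by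
  intro x hx y hy hxy
  obtain ⟨a, ha, ham, rfl⟩ := (h.mem_successors hK).1 hx
  obtain ⟨b, hb, hbm, rfl⟩ := (h.mem_successors hK).1 hy
  rcases lt_trichotomy a b with hab | rfl | hab
  · exact h.not_adj_succ_succ hK ha (hb.resolve_left (by omega)) hab hxy
  · exact G.irrefl hxy
  · exact h.not_adj_succ_succ hK hb (ha.resolve_left (by omega)) hab hxy.symm

theorem predecessors_independent :
    ∀ x ∈ G.predecessors m f K, ∀ y ∈ G.predecessors m f K, ¬ G.Adj x y := by
  intro x hx y hy hxy
  obtain ⟨a, ha, -, ham, rfl⟩ := (h.mem_predecessors hK).1 hx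
  obtain ⟨b, hb, -, hbm, rfl⟩ := (h.mem_predecessors hK).1 hy
  rcases lt_trichotomy a b with hab | rfl | hab
  · exact h.not_adj_pred_pred hK (ha.resolve_left (by omega)) hb hab hxy
  · exact G.irrefl hxy
  · exact h.not_adj_pred_pred hK (hb.resolve_left (by omega)) ha hab hxy.symm

theorem succ_notMem {a : ℕ} (ha : a = 0 ∨ a ∈ G.attachments m f K) :
    a + 1 ∉ G.attachments m f K := by
  rcases ha with rfl | ha
  · exact h.one_notMem_attachments hK
  · exact h.succ_notMem_attachments hK ha

theorem pred_notMem {a : ℕ} (ha1 : 1 < a) (ha : a = m + 1 ∨ a ∈ G.attachments m f K) :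
    a - 1 ∉ G.attachments m f K := by
  rcases ha with rfl | ha
  · simpa using h.last_notMem_attachments hK
  · intro h'
    have := h.succ_notMem_attachments hK h'
    rw [Nat.sub_add_cancel ha1.le] at this
    exact this ha

theorem successors_notMem : ∀ x ∈ G.successors m f K, x ∉ K := by
  intro x hx hxK
  obtain ⟨a, ha, ham, rfl⟩ := (h.mem_successors hK).1 hx
  exact hK.off _ hxK (a + 1) (by omega) ham rfl

theorem predecessors_notMem : ∀ x ∈ G.predecessors m f K, x ∉ K := by
  intro x hx hxK
  obtain ⟨a, ha, ha1, ham, rfl⟩ := (h.mem_predecessors hK).1 hx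
  exact hK.off _ hxK (a - 1) (by omega) (by omega) rfl

theorem successors_not_adj : ∀ x ∈ G.successors m f K, ∀ y ∈ K, ¬ G.Adj x y := by
  intro x hx
  obtain ⟨a, ha, ham, rfl⟩ := (h.mem_successors hK).1 hx
  exact not_adj_of_notMem_attachments (by omega) ham (h.succ_notMem hK ha)

theorem predecessors_not_adj : ∀ x ∈ G.predecessors m f K, ∀ y ∈ K, ¬ G.Adj x y := by
  intro x hx
  obtain ⟨a, ha, ha1, ham, rfl⟩ := (h.mem_predecessors hK).1 hx
  exact not_adj_of_notMem_attachments (by omega) (by omega) (h.pred_notMem hK ha1 ha)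

end IsLongestPath

end Counting

end SimpleGraph

/-! ### Exact counts, the case of no attachments, and the size of the component -/

namespace SimpleGraph

variable {V : Type*} {G : SimpleGraph V} {s t : ℕ} {m : ℕ} {f : ℕ → V} {K : Finset V}

namespace IsLongestPath

variable (h : G.IsLongestPath m f) (hK : G.IsOffPathComponent m f K)
include h hK

/-- If this failed, the successors and `K` would give a hole, unless there are fewer than `s`
successors. In that case `K` has more than `t` vertices, so fewer than `s` vertices lie outside `K`
and the attachments, and `f 1` has too small a degree. -/
theorem card_add_card_le [Fintype V] (hst : s ≤ t) (hno : ¬ G.HasBipartiteHole s t)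
    (hdeg : ∀ (v : V) (N : Finset V), (∀ u, G.Adj v u → u ∈ N) → s + t ≤ N.card + 3) :
    K.card + (G.attachments m f K).card + 2 ≤ s + t := by
  classical
  by_contra hlt
  have hI := h.card_successors hK
  by_cases hs : s ≤ (G.successors m f K).card
  · exact hno (hasBipartiteHole_of_independent subset_rfl (h.successors_independent hK)
      (h.successors_notMem hK) (h.successors_not_adj hK) hs (by omega))
  let Z := (G.attachments m f K).image f
  have hZ : Z.card = (G.attachments m f K).card := h.card_image_attachments hK
  let L := Finset.univ \ (K ∪ Z)
  have hL : L.card < s := by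
    by_contra hL
    refine hno (hasBipartiteHole_of_le (S := L) (T := K) (by omega) (by omega) ?_ ?_)
    · rw [Finset.disjoint_left]
      exact fun x hx hxK => (Finset.mem_sdiff.1 hx).2 (Finset.mem_union_left _ hxK)
    · intro x hx y hy hxy
      have hx' := (Finset.mem_sdiff.1 hx).2
      rcases hK.closed y hy x hxy.symm with hxK | ⟨i, h1, h2, rfl⟩
      · exact hx' (Finset.mem_union_left _ hxK)
      · exact hx' (Finset.mem_union_right _ (Finset.mem_image_of_mem f
          (mem_attachments.2 ⟨h1, h2, y, hy, hxy⟩)))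
  have h1K : f 1 ∉ K := fun h1 => hK.off _ h1 1 le_rfl (h.one_le hK) rfl
  have h1Z : f 1 ∉ Z := by
    intro h1
    obtain ⟨a, ha, hfa⟩ := Finset.mem_image.1 h1
    have hb := h.one_lt_of_mem hK ha
    have := h.inj a 1 (by omega) (by omega) le_rfl (by omega) hfa
    omega
  have h1L : f 1 ∈ L := by simp [L, h1K, h1Z]
  have hd := hdeg (f 1) (L.erase (f 1) ∪ Z) (by
    intro u hu
    have huK : u ∉ K := fun huK => not_adj_of_notMem_attachments le_rfl (h.one_le hK)
      (h.one_notMem_attachments hK) u huK hu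
    by_cases huZ : u ∈ Z
    · exact Finset.mem_union_right _ huZ
    · refine Finset.mem_union_left _ (Finset.mem_erase.2 ⟨hu.ne', ?_⟩)
      simp [L, huK, huZ])
  have hc := Finset.card_union_le (L.erase (f 1)) Z
  rw [Finset.card_erase_of_mem h1L] at hc
  have := Finset.card_pos.2 ⟨_, h1L⟩
  omega

/-- Counting the neighbors of a vertex of `K` gives exact values. -/
theorem component_structure [Fintype V] (hst : s ≤ t) (hno : ¬ G.HasBipartiteHole s t)
    (hdeg : ∀ (v : V) (N : Finset V), (∀ u, G.Adj v u → u ∈ N) → s + t ≤ N.card + 3) :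
    K.card + (G.attachments m f K).card + 2 = s + t ∧
      (∀ x ∈ K, ∀ y ∈ K, x ≠ y → G.Adj x y) ∧
      (∀ i ∈ G.attachments m f K, ∀ c ∈ K, G.Adj (f i) c) := by
  classical
  have hle := h.card_add_card_le hK hst hno hdeg
  let Z := (G.attachments m f K).image f
  have hZ : Z.card = (G.attachments m f K).card := h.card_image_attachments hK
  have hpos := hK.nonempty.card_pos
  -- The possible neighbors of `c` number at most `|K| - 1 + |Z| ≤ s + t - 3`, so the degree bound
  -- allows none to be missing.
  have key : ∀ c ∈ K, ∀ x ∈ K.erase c ∪ Z, G.Adj c x := by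
    intro c hc x hx
    by_contra hcx
    have hd := hdeg c ((K.erase c ∪ Z).erase x) (by
      intro u hu
      refine Finset.mem_erase.2 ⟨?_, ?_⟩
      · rintro rfl
        exact hcx hu
      rcases hK.closed c hc u hu with huK | ⟨i, h1, h2, rfl⟩
      · exact Finset.mem_union_left _ (Finset.mem_erase.2 ⟨hu.ne', huK⟩)
      · exact Finset.mem_union_right _ (Finset.mem_image_of_mem f
          (mem_attachments.2 ⟨h1, h2, c, hc, hu.symm⟩)))
    rw [Finset.card_erase_of_mem hx] at hd
    have hcu := Finset.card_union_le (K.erase c) Z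
    rw [Finset.card_erase_of_mem hc] at hcu
    have := Finset.card_pos.2 ⟨_, hx⟩
    omega
  obtain ⟨c, hc⟩ := hK.nonempty
  have hd := hdeg c (K.erase c ∪ Z) (by
    intro u hu
    rcases hK.closed c hc u hu with huK | ⟨i, h1, h2, rfl⟩
    · exact Finset.mem_union_left _ (Finset.mem_erase.2 ⟨hu.ne', huK⟩)
    · exact Finset.mem_union_right _ (Finset.mem_image_of_mem f
        (mem_attachments.2 ⟨h1, h2, c, hc, hu.symm⟩)))
  have hcu := Finset.card_union_le (K.erase c) Z
  rw [Finset.card_erase_of_mem hc] at hcu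
  refine ⟨by omega, ?_, ?_⟩
  · intro x hx y hy hxy
    exact key x hx y (Finset.mem_union_left _ (Finset.mem_erase.2 ⟨hxy.symm, hy⟩))
  · intro i hi c hc
    exact (key c hc _ (Finset.mem_union_right _ (Finset.mem_image_of_mem f hi))).symm

/-- If nothing is attached to the path, the graph is the union of two cliques. -/
theorem two_cliques [Fintype V] (hs : 1 ≤ s) (hst : s ≤ t) (hno : ¬ G.HasBipartiteHole s t)
    (hdeg : ∀ (v : V) (N : Finset V), (∀ u, G.Adj v u → u ∈ N) → s + t ≤ N.card + 3)
    (hZ : G.attachments m f K = ∅) [DecidableEq V] :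
    K.card = Kᶜ.card ∧ (∀ x ∈ K, ∀ y ∈ K, x ≠ y → G.Adj x y) ∧
      (∀ x ∉ K, ∀ y ∉ K, x ≠ y → G.Adj x y) ∧ (∀ x ∈ K, ∀ y ∉ K, ¬ G.Adj x y) := by
  obtain ⟨hcard, hcl, -⟩ := h.component_structure hK hst hno hdeg
  rw [hZ, Finset.card_empty] at hcard
  have hsep : ∀ x ∈ K, ∀ y ∉ K, ¬ G.Adj x y := by
    intro x hx y hy hxy
    rcases hK.closed x hx y hxy with hyK | ⟨i, h1, h2, rfl⟩
    · exact hy hyK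
    · have := mem_attachments.2 ⟨h1, h2, x, hx, hxy.symm⟩
      simp [hZ] at this
  have hpos := hK.nonempty.card_pos
  have h1K : f 1 ∈ Kᶜ := by
    rw [Finset.mem_compl]
    exact fun h1 => hK.off _ h1 1 le_rfl (h.one_le hK) rfl
  have hout : ∀ v ∉ K, s + t ≤ Kᶜ.card + 2 := by
    intro v hv
    have hv' := Finset.mem_compl.2 hv
    have := hdeg v (Kᶜ.erase v) (by
      intro u hu
      refine Finset.mem_erase.2 ⟨hu.ne', Finset.mem_compl.2 ?_⟩
      exact fun huK => hsep u huK v hv hu.symm)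
    rw [Finset.card_erase_of_mem hv'] at this
    have := Finset.card_pos.2 ⟨_, hv'⟩
    omega
  have hlarge := hout _ (Finset.mem_compl.1 h1K)
  -- If `s ≥ 2`, then `|K| = s + t - 2 ≥ t`, and the complement, at least as large as `K`, supplies
  -- the `s` vertices of a hole.
  have hs1 : s = 1 := by
    by_contra hs1
    refine hno (hasBipartiteHole_of_le (S := Kᶜ) (T := K) (by omega) (by omega)
      disjoint_compl_left ?_)
    exact fun x hx y hy hxy => hsep y hy x (Finset.mem_compl.1 hx) hxy.symm
  have hsmall : Kᶜ.card < t := by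
    by_contra hsmall
    refine hno (hasBipartiteHole_of_le (S := K) (T := Kᶜ) (by omega) (by omega)
      disjoint_compl_right ?_)
    exact fun x hx y hy => hsep x hx y (Finset.mem_compl.1 hy)
  refine ⟨by omega, hcl, ?_, hsep⟩
  intro x hx y hy hxy
  by_contra hadj
  have hx' := Finset.mem_compl.2 hx
  have hy' : y ∈ Kᶜ.erase x := Finset.mem_erase.2 ⟨hxy.symm, Finset.mem_compl.2 hy⟩
  have := hdeg x ((Kᶜ.erase x).erase y) (by
    intro u hu
    refine Finset.mem_erase.2 ⟨?_, Finset.mem_erase.2 ⟨hu.ne', Finset.mem_compl.2 ?_⟩⟩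
    · rintro rfl
      exact hadj hu
    · exact fun huK => hsep u huK x hx hu.symm)
  rw [Finset.card_erase_of_mem hy', Finset.card_erase_of_mem hx'] at this
  have h1 := Finset.card_pos.2 ⟨_, hy'⟩
  rw [Finset.card_erase_of_mem hx'] at h1
  omega

/-- The first vertex of the path has many nonneighbors among the predecessors of the
attachments. -/
theorem exists_nonneighbors_first [DecidableEq V] (hZ : (G.attachments m f K).Nonempty) :
    ∃ W ⊆ G.predecessors m f K, W.card = (G.attachments m f K).card ∧
      ∀ y ∈ W, ¬ G.Adj (f 1) y := by
  let Z := G.attachments m f K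
  let z := Z.min' hZ
  have hz : z ∈ Z := Z.min'_mem hZ
  have hsub : ∀ b ∈ insert (m + 1) (Z.erase z), b = m + 1 ∨ b ∈ Z := by
    intro b hb
    rcases Finset.mem_insert.1 hb with rfl | hb
    · exact Or.inl rfl
    · exact Or.inr (Finset.mem_of_mem_erase hb)
  refine ⟨(insert (m + 1) (Z.erase z)).image fun a => f (a - 1), ?_, ?_, ?_⟩
  · intro v hv
    obtain ⟨b, hb, rfl⟩ := Finset.mem_image.1 hv
    refine (h.mem_predecessors hK).2 ⟨b, hsub b hb, ?_, ?_, rfl⟩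
    · rcases hsub b hb with rfl | hb
      · have := h.one_le hK
        omega
      · exact (h.one_lt_of_mem hK hb).1
    · rcases hsub b hb with rfl | hb
      · exact le_rfl
      · have := (h.one_lt_of_mem hK hb).2
        omega
  · rw [h.card_image_pred hK hsub, Finset.card_insert_of_notMem, Finset.card_erase_of_mem hz]
    · have := Finset.card_pos.2 hZ
      simp only [Z]
      omega
    · intro hm
      have := h.one_lt_of_mem hK (Finset.mem_of_mem_erase hm)
      omega
  · intro v hv
    obtain ⟨b, hb, rfl⟩ := Finset.mem_image.1 hv
    refine h.not_adj_first_pred hK hz (hsub b hb) ?_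
    rcases Finset.mem_insert.1 hb with rfl | hb
    · have := h.one_lt_of_mem hK hz
      omega
    · exact lt_of_le_of_ne (Z.min'_le b (Finset.mem_of_mem_erase hb)) (Finset.ne_of_mem_erase hb).symm

/-- A clique `K` with at least two vertices forces at least `|K|` path vertices before and after
every attachment; these end pieces have no edges to `K` and leave room for a hole. -/
theorem card_component_le_one [Fintype V] (hst : s ≤ t)
    (hno : ¬ G.HasBipartiteHole s t)
    (hdeg : ∀ (v : V) (N : Finset V), (∀ u, G.Adj v u → u ∈ N) → s + t ≤ N.card + 3)
    (hZ : (G.attachments m f K).Nonempty) : K.card ≤ 1 := by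
  classical
  by_contra hK1
  obtain ⟨hcard, hcl, hfull⟩ := h.component_structure hK hst hno hdeg
  have hseg : ∀ z ∈ G.attachments m f K, K.card + 1 ≤ z ∧ z + K.card ≤ m :=
    fun z hz => h.card_lt_of_clique hK hcl hfull hz
  obtain ⟨z, hz⟩ := hZ
  obtain ⟨hz1, hz2⟩ := hseg z hz
  have h1K : f 1 ∉ K := fun h1 => hK.off _ h1 1 le_rfl (h.one_le hK) rfl
  have hpos := Finset.card_pos.2 ⟨z, hz⟩
  -- Otherwise `f 1` can join `K` against `s` of its nonneighbors among the predecessors; it is not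
  -- itself a predecessor since 2 is not an attachment.
  have hks : (G.attachments m f K).card < s := by
    by_contra hks
    obtain ⟨W, hW, hWc, hW1⟩ := h.exists_nonneighbors_first hK ⟨z, hz⟩
    refine hno (hasBipartiteHole_of_independent_of_notMem (x := f 1) (K := K) hW
      (h.predecessors_independent hK)
      (h.predecessors_notMem hK) (fun x hx => h.predecessors_not_adj hK x (hW hx)) ?_ h1K hW1
      (by omega) ?_)
    · intro h1
      obtain ⟨a, ha, ha1, ham, hfa⟩ := (h.mem_predecessors hK).1 h1
      have := h.inj (a - 1) 1 (by omega) (by omega) le_rfl (by omega) hfa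
      rcases ha with rfl | ha
      · omega
      · have := hseg a ha
        omega
    · rw [h.card_predecessors hK]
      omega
  -- By now `|K| ≥ t - 1`, so the two end pieces together contain `2|K| ≥ t` vertices.
  by_cases hKs : s ≤ K.card
  · let A := (Finset.Icc 1 K.card ∪ Finset.Icc (m + 1 - K.card) m)
    have hAm : ∀ i ∈ A, 1 ≤ i ∧ i ≤ m ∧ i ∉ G.attachments m f K := by
      intro i hi
      simp only [A, Finset.mem_union, Finset.mem_Icc] at hi
      refine ⟨by omega, by omega, fun h' => ?_⟩
      have := hseg i h'
      omega
    have hA : (A.image f).card = 2 * K.card := by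
      rw [Finset.card_image_of_injOn, Finset.card_union_of_disjoint]
      · simp only [Nat.card_Icc]
        omega
      · rw [Finset.disjoint_left]
        intro i hi hi'
        simp only [Finset.mem_Icc] at hi hi'
        omega
      · intro i hi j hj hij
        have h1 := hAm i hi
        have h2 := hAm j hj
        exact h.inj i j h1.1 h1.2.1 h2.1 h2.2.1 hij
    refine hno (hasBipartiteHole_of_le (S := K) (T := A.image f) hKs (by omega) ?_ ?_)
    · rw [Finset.disjoint_right]
      intro v hv hvK
      obtain ⟨i, hi, rfl⟩ := Finset.mem_image.1 hv
      exact hK.off _ hvK i (hAm i hi).1 (hAm i hi).2.1 rfl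
    · intro x hx y hy hxy
      obtain ⟨i, hi, rfl⟩ := Finset.mem_image.1 hy
      obtain ⟨h1, h2, h3⟩ := hAm i hi
      exact not_adj_of_notMem_attachments h1 h2 h3 x hx hxy.symm
  -- Here `s = t` and `|K| = |Z| = s - 1`. The hole has sides `K ∪ {f 1}` and the successors of
  -- attachments with `f m`; the position `m - 1` is added so that its successor is `m`.
  · let B := insert (m - 1) (G.attachments m f K)
    have hB : ∀ b ∈ B, 1 ≤ b ∧ b + 1 ≤ m ∧ b + 1 ∉ G.attachments m f K ∧
        ¬ G.Adj (f 1) (f (b + 1)) := by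
      intro b hb
      rcases Finset.mem_insert.1 hb with rfl | hb
      · have h1 : m - 1 + 1 = m := by omega
        rw [h1]
        exact ⟨by omega, le_rfl, h.last_notMem_attachments hK,
          h.not_adj_first_pred hK hz (Or.inl rfl) (by omega)⟩
      · have := h.one_lt_of_mem hK hb
        exact ⟨by omega, by omega, h.succ_notMem_attachments hK hb,
          h.not_adj_succ_succ hK (Or.inl rfl) hb (by omega)⟩
    have hBc : (B.image fun b => f (b + 1)).card = (G.attachments m f K).card + 1 := by
      rw [Finset.card_image_of_injOn, Finset.card_insert_of_notMem]
      · intro h'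
        have := hseg _ h'
        omega
      · intro i hi j hj hij
        have h1 := hB i hi
        have h2 := hB j hj
        have := h.inj (i + 1) (j + 1) (by omega) h1.2.1 (by omega) h2.2.1 hij
        omega
    refine hno (hasBipartiteHole_of_le (S := insert (f 1) K) (T := B.image fun b => f (b + 1))
      ?_ (by omega) ?_ ?_)
    · rw [Finset.card_insert_of_notMem h1K]
      omega
    · rw [Finset.disjoint_right]
      intro v hv hvK
      obtain ⟨b, hb, rfl⟩ := Finset.mem_image.1 hv
      obtain ⟨h1, h2, h3, h4⟩ := hB b hb
      rcases Finset.mem_insert.1 hvK with hvK | hvK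
      · have := h.inj (b + 1) 1 (by omega) h2 le_rfl (by omega) hvK
        omega
      · exact hK.off _ hvK (b + 1) (by omega) h2 rfl
    · intro x hx y hy hxy
      obtain ⟨b, hb, rfl⟩ := Finset.mem_image.1 hy
      obtain ⟨h1, h2, h3, h4⟩ := hB b hb
      rcases Finset.mem_insert.1 hx with rfl | hx
      · exact h4 hxy
      · exact not_adj_of_notMem_attachments (by omega) h2 h3 x hx hxy.symm

end IsLongestPath

end SimpleGraph

/-! ### A single vertex off the path: the alternating structure -/

namespace SimpleGraph

variable {V : Type*} {G : SimpleGraph V} {s t : ℕ} {m : ℕ} {f : ℕ → V} {K : Finset V}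

theorem independent_insert [DecidableEq V] {I : Finset V} {c : V}
    (hI : ∀ x ∈ I, ∀ y ∈ I, ¬ G.Adj x y) (hc : ∀ x ∈ I, ¬ G.Adj x c) :
    ∀ x ∈ insert c I, ∀ y ∈ insert c I, ¬ G.Adj x y := by
  intro x hx y hy hxy
  rcases Finset.mem_insert.1 hx with rfl | hxI <;> rcases Finset.mem_insert.1 hy with rfl | hyI
  · exact G.irrefl hxy
  · exact hc y hyI hxy.symm
  · exact hc x hxI hxy
  · exact hI x hxI y hyI hxy

namespace IsLongestPath

variable (h : G.IsLongestPath m f) (hK : G.IsOffPathComponent m f K)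
include h hK

/-- If 2 were not an attachment, `f 1` would lie outside the independent set of `c` and the
predecessors, which has `s + t - 1` vertices. It would miss at least `|Z| + 1 ≥ s` of them, so
adding it would complete a hole. -/
theorem two_mem_attachments {c : V} (hKc : K = {c}) (hst : s ≤ t)
    (hno : ¬ G.HasBipartiteHole s t) (hZ : (G.attachments m f K).Nonempty)
    (hcard : (G.attachments m f K).card + 3 = s + t) : 2 ∈ G.attachments m f K := by
  classical
  by_contra h2
  have hc : c ∈ K := by simp [hKc]
  have hcJ : c ∉ G.predecessors m f K := fun h' => h.predecessors_notMem hK c h' hc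
  have hpos := Finset.card_pos.2 hZ
  obtain ⟨z, hz⟩ := id hZ
  have hz1 := h.one_lt_of_mem hK hz
  obtain ⟨W, hW, hWc, hW1⟩ := h.exists_nonneighbors_first hK hZ
  refine hno (hasBipartiteHole_of_independent_of_notMem (x := f 1) (K := ∅)
    (Finset.insert_subset_insert c hW) (independent_insert (h.predecessors_independent hK)
    (fun x hx => h.predecessors_not_adj hK x hx c hc)) (by simp) (by simp) ?_ (by simp) ?_ ?_ ?_)
  · intro h1
    rcases Finset.mem_insert.1 h1 with h1 | h1
    · exact hK.off c hc 1 le_rfl (h.one_le hK) h1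
    · obtain ⟨a, ha, ha1, ham, hfa⟩ := (h.mem_predecessors hK).1 h1
      have := h.inj (a - 1) 1 (by omega) (by omega) le_rfl (by omega) hfa
      obtain rfl : a = 2 := by omega
      exact h2 (ha.resolve_left (by omega))
  · intro y hy
    rcases Finset.mem_insert.1 hy with rfl | hy
    · exact not_adj_of_notMem_attachments le_rfl (by omega) (h.one_notMem_attachments hK) _ hc
    · exact hW1 y hy
  · rw [Finset.card_insert_of_notMem (fun h' => hcJ (hW h'))]
    omega
  · rw [Finset.card_insert_of_notMem hcJ, h.card_predecessors hK, Finset.card_empty]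
    omega

/-- Consecutive attachments of a single vertex have distance two on the path. -/
theorem add_two_mem_attachments {c : V} (hKc : K = {c}) (hst : s ≤ t)
    (hno : ¬ G.HasBipartiteHole s t) (hZ : (G.attachments m f K).Nonempty)
    (hcard : (G.attachments m f K).card + 3 = s + t) :
    ∀ i ∈ G.attachments m f K, i + 2 = m + 1 ∨ i + 2 ∈ G.attachments m f K := by
  classical
  set Z := G.attachments m f K with hZdef
  by_contra! hlong
  have h2 : 2 ∈ Z := h.two_mem_attachments hK hKc hst hno hZ hcard
  have hc : c ∈ K := by simp [hKc]
  have hpos := Finset.card_pos.2 hZ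
  have hne : (Z.filter fun i => ¬ (i + 2 = m + 1 ∨ i + 2 ∈ Z)).Nonempty := by
    obtain ⟨i, hi, h3⟩ := hlong
    exact ⟨i, Finset.mem_filter.2 ⟨hi, by tauto⟩⟩
  -- Take the last long gap: beyond `i` the path alternates, so predecessors past the next
  -- attachment are also successors.
  obtain ⟨i, hi, himax⟩ := Finset.exists_max_image _ id hne
  obtain ⟨hiZ, hi2⟩ := Finset.mem_filter.1 hi
  have hshort : ∀ z ∈ Z, i < z → z + 2 = m + 1 ∨ z + 2 ∈ Z := by
    intro z hz hiz
    by_contra hz2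
    have := himax z (Finset.mem_filter.2 ⟨hz, hz2⟩)
    simp only [id] at this
    omega
  have him := h.one_lt_of_mem hK hiZ
  have hpred : ∀ b, (b = m + 1 ∨ b ∈ Z) → ∀ a ∈ Z, i < a → a < b →
      ¬ G.Adj (f (i + 1)) (f (b - 1)) := by
    intro b hb a ha hia hab
    obtain ⟨z, hz, hzmax⟩ := Finset.exists_max_image (Z.filter fun z => i < z ∧ z < b) id
      ⟨a, Finset.mem_filter.2 ⟨ha, hia, hab⟩⟩
    obtain ⟨hzZ, hiz, hzb⟩ := Finset.mem_filter.1 hz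
    have hzm := h.one_lt_of_mem hK hzZ
    have hb1 : b ≠ z + 1 := by
      rintro rfl
      rcases hb with hb | hb
      · omega
      · exact h.succ_notMem_attachments hK hzZ hb
    have hb2 : b = z + 2 := by
      by_contra hb2
      have hbm : b ≤ m + 1 := by
        rcases hb with hb | hb
        · omega
        · have := h.one_lt_of_mem hK hb
          omega
      have := hzmax (z + 2) (Finset.mem_filter.2
        ⟨(hshort z hzZ hiz).resolve_left (by omega), by omega, by omega⟩)
      simp only [id] at this
      omega
    subst hb2
    exact h.not_adj_succ_succ hK (Or.inr hiZ) hzZ hiz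
  let J := insert c (G.predecessors m f K)
  have hcJ : c ∉ G.predecessors m f K := fun h' => h.predecessors_notMem hK c h' hc
  have hJc : J.card = s + t - 1 := by
    simp only [J]
    rw [Finset.card_insert_of_notMem hcJ, h.card_predecessors hK, ← hZdef]
    omega
  -- The gap after `i` keeps `f (i + 1)` out of `J`, so `s` nonneighbors in `J` would yield a hole.
  -- Hence `f (i + 1)` has at least `t` neighbors in `J`.
  have hW : (J.filter fun y => ¬ G.Adj (f (i + 1)) y).card < s := by
    by_contra hW
    refine hno (hasBipartiteHole_of_independent_of_notMem (x := f (i + 1)) (K := ∅) (I := J)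
      (Finset.filter_subset _ _) (independent_insert (h.predecessors_independent hK)
      (fun x hx => h.predecessors_not_adj hK x hx c hc)) (by simp) (by simp) ?_ (by simp)
      (fun y hy => (Finset.mem_filter.1 hy).2) (not_lt.1 hW) ?_)
    · intro h1
      rcases Finset.mem_insert.1 h1 with h1 | h1
      · exact hK.off c hc (i + 1) (by omega) (by omega) h1
      · obtain ⟨a, ha, ha1, ham, hfa⟩ := (h.mem_predecessors hK).1 h1
        have := h.inj (a - 1) (i + 1) (by omega) (by omega) (by omega) (by omega) hfa
        obtain rfl : a = i + 2 := by omega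
        exact hi2 ha
    · rw [hJc, Finset.card_empty]
      omega
  let Y := (insert (m + 1) Z).filter fun a => G.Adj (f (i + 1)) (f (a - 1))
  have hY : t ≤ Y.card := by
    have h1 : (J.filter fun y => G.Adj (f (i + 1)) y) ⊆ Y.image fun a => f (a - 1) := by
      intro y hy
      obtain ⟨hyJ, hadj⟩ := Finset.mem_filter.1 hy
      rcases Finset.mem_insert.1 hyJ with rfl | hyJ
      · exact absurd hadj (not_adj_of_notMem_attachments (by omega) him.2
          (h.succ_notMem_attachments hK hiZ) _ hc)
      · obtain ⟨a, ha, -, -, rfl⟩ := (h.mem_predecessors hK).1 hyJ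
        exact Finset.mem_image_of_mem _ (Finset.mem_filter.2 ⟨Finset.mem_insert.2 ha, hadj⟩)
    have h2 := (Finset.card_le_card h1).trans Finset.card_image_le
    have h3 := Finset.card_filter_add_card_filter_not (s := J) (fun y => G.Adj (f (i + 1)) y)
    omega
  have hYZ : ∀ a ∈ Y, (a = m + 1 ∨ a ∈ Z) ∧ G.Adj (f (i + 1)) (f (a - 1)) := by
    intro a ha
    exact ⟨Finset.mem_insert.1 (Finset.mem_filter.1 ha).1, (Finset.mem_filter.1 ha).2⟩
  have hYlt : ∀ a ∈ Y, ∀ b ∈ Y, i < a → ¬ a < b := by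
    intro a ha b hb hia hab
    have hbm : b ≤ m + 1 := by
      rcases (hYZ b hb).1 with hb | hb
      · omega
      · have := h.one_lt_of_mem hK hb
        omega
    exact hpred b (hYZ b hb).1 a ((hYZ a ha).1.resolve_left (by omega)) hia hab (hYZ b hb).2
  have hYgt : (Y.filter fun a => ¬ a ≤ i).card ≤ 1 := by
    rw [Finset.card_le_one]
    intro a ha b hb
    obtain ⟨ha, hia⟩ := Finset.mem_filter.1 ha
    obtain ⟨hb, hib⟩ := Finset.mem_filter.1 hb
    have h1 := hYlt a ha b hb (by omega)
    have h2 := hYlt b hb a ha (by omega)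
    omega
  have hYadd := Finset.card_filter_add_card_filter_not (s := Y) (fun a => a ≤ i)
  have hY2 : 2 ∉ Y := by
    intro h'
    exact h.not_adj_succ_succ hK (Or.inl rfl) hiZ (by omega) (hYZ 2 h').2.symm
  obtain ⟨j, hj, hjmax⟩ := Finset.exists_max_image (Y.filter fun a => a ≤ i) id
    (Finset.card_pos.1 (by omega))
  obtain ⟨hjY, hji⟩ := Finset.mem_filter.1 hj
  have hjZ : j ∈ Z := (hYZ j hjY).1.resolve_left (by omega)
  have hj1 := h.one_lt_of_mem hK hjZ
  have hj2 : j ≠ 2 := by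
    rintro rfl
    exact hY2 hjY
  -- At most one element of `Y` exceeds `i`. Dropping it and `j`, and adding 0 and 2, neither in
  -- `Y`, leaves at least `t` positions below `j`.
  let E := (insert 0 Z).filter fun a => a < j
  have hE : t ≤ E.card := by
    have hsub : insert 0 (insert 2 ((Y.filter fun a => a ≤ i).erase j)) ⊆ E := by
      intro a ha
      simp only [Finset.mem_insert] at ha
      rcases ha with rfl | rfl | ha
      · exact Finset.mem_filter.2 ⟨Finset.mem_insert_self _ _, by omega⟩
      · exact Finset.mem_filter.2 ⟨Finset.mem_insert_of_mem h2, by omega⟩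
      · obtain ⟨haj, ha⟩ := Finset.mem_erase.1 ha
        have hle := hjmax a ha
        simp only [id] at hle
        obtain ⟨haY, hai⟩ := Finset.mem_filter.1 ha
        exact Finset.mem_filter.2 ⟨Finset.mem_insert_of_mem
          ((hYZ a haY).1.resolve_left (by omega)), by omega⟩
    have h0Z : 0 ∉ Y := by
      intro h'
      rcases (hYZ 0 h').1 with h' | h'
      · omega
      · have := h.one_lt_of_mem hK h'
        omega
    have hcardE := Finset.card_le_card hsub
    rw [Finset.card_insert_of_notMem, Finset.card_insert_of_notMem,
      Finset.card_erase_of_mem hj] at hcardE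
    · omega
    · intro h'
      exact hY2 (Finset.mem_filter.1 (Finset.mem_of_mem_erase h')).1
    · intro h'
      rcases Finset.mem_insert.1 h' with h' | h'
      · omega
      · exact h0Z (Finset.mem_filter.1 (Finset.mem_of_mem_erase h')).1
  have hEZ : ∀ a ∈ E, (a = 0 ∨ a ∈ Z) ∧ a < j := by
    intro a ha
    exact ⟨Finset.mem_insert.1 (Finset.mem_filter.1 ha).1, (Finset.mem_filter.1 ha).2⟩
  have hEI : (E.image fun a => f (a + 1)) ⊆ G.successors m f K := by
    intro v hv
    obtain ⟨a, ha, rfl⟩ := Finset.mem_image.1 hv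
    have := hEZ a ha
    exact (h.mem_successors hK).2 ⟨a, this.1, by omega, rfl⟩
  -- The edge from `f (i + 1)` to `f (j - 1)` forbids edges from `f i` to the successors of `E`, so
  -- `f i` may join `c` opposite them.
  refine hno (hasBipartiteHole_of_independent_of_notMem (x := f i) (K := K) hEI
    (h.successors_independent hK) (h.successors_notMem hK)
    (fun x hx => h.successors_not_adj hK x (hEI hx)) ?_ ?_ ?_ ?_ ?_)
  · intro h'
    obtain ⟨a, ha, ham, hfa⟩ := (h.mem_successors hK).1 h'
    have := h.inj (a + 1) i (by omega) (by omega) (by omega) (by omega) hfa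
    subst this
    exact h.succ_notMem hK ha hiZ
  · exact fun h' => hK.off _ h' i (by omega) (by omega) rfl
  · intro y hy hadj
    obtain ⟨a, ha, rfl⟩ := Finset.mem_image.1 hy
    exact h.not_adj_and_adj hK hc (by simp [hKc]) (hEZ a ha).1 hjZ hiZ (hEZ a ha).2 hji
      ⟨hadj.symm, (hYZ j hjY).2⟩
  · rw [h.card_image_succ hK (fun a ha => (hEZ a ha).1)]
    omega
  · rw [h.card_successors hK, hKc, Finset.card_singleton, ← hKc, ← hZdef]
    omega

/-- If something is attached to the path, the graph is the join of a graph with an independent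
set that has two more vertices. -/
theorem independent_join [Fintype V] [DecidableEq V] (hst : s ≤ t)
    (hno : ¬ G.HasBipartiteHole s t)
    (hdeg : ∀ (v : V) (N : Finset V), (∀ u, G.Adj v u → u ∈ N) → s + t ≤ N.card + 3)
    (hZ : (G.attachments m f K).Nonempty) :
    ∃ I : Finset V, I.card = Iᶜ.card + 2 ∧ (∀ x ∈ I, ∀ y ∈ I, ¬ G.Adj x y) ∧
      ∀ x ∈ I, ∀ y ∉ I, G.Adj x y := by
  obtain ⟨hcard, -, hfull⟩ := h.component_structure hK hst hno hdeg
  have hK1 : K.card = 1 := by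
    have h1 := h.card_component_le_one hK hst hno hdeg hZ
    have h2 := hK.nonempty.card_pos
    omega
  obtain ⟨c, hKc⟩ := Finset.card_eq_one.1 hK1
  have hc : c ∈ K := by simp [hKc]
  have hcard' : (G.attachments m f K).card + 3 = s + t := by omega
  have h2 := h.two_mem_attachments hK hKc hst hno hZ hcard'
  have hstep := h.add_two_mem_attachments hK hKc hst hno hZ hcard'
  have hcover : ∀ p, 1 ≤ p → p ≤ m →
      p ∈ G.attachments m f K ∨ p - 1 = 0 ∨ p - 1 ∈ G.attachments m f K := by
    intro p hp
    induction p, hp using Nat.le_induction with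
    | base => simp
    | succ p hp ih =>
      intro hpm
      rw [Nat.add_sub_cancel]
      rcases ih (by omega) with h' | h' | h'
      · exact Or.inr (Or.inr h')
      · obtain rfl : p = 1 := by omega
        exact Or.inl h2
      · have e : p - 1 + 2 = p + 1 := by omega
        have := hstep _ h'
        rw [e] at this
        exact Or.inl (this.resolve_left (by omega))
  let I := insert c (G.successors m f K)
  have hcI : c ∉ G.successors m f K := fun h' => h.successors_notMem hK c h' hc
  have hI : ∀ x ∈ I, ∀ y ∈ I, ¬ G.Adj x y :=
    independent_insert (h.successors_independent hK)
      (fun x hx => h.successors_not_adj hK x hx c hc)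
  have hIc : I.card = (G.attachments m f K).card + 2 := by
    simp only [I]
    rw [Finset.card_insert_of_notMem hcI, h.card_successors hK]
  -- Any further vertex would be nonadjacent to all of `I`, giving `s + t` independent vertices and
  -- hence a hole.
  have hcompl : Iᶜ = (G.attachments m f K).image f := by
    ext x
    rw [Finset.mem_compl, Finset.mem_image]
    constructor
    · intro hx
      have hxc : x ≠ c := fun h' => hx (by simp [I, h'])
      have hxS : x ∉ G.successors m f K := fun h' => hx (Finset.mem_insert_of_mem h')
      by_contra hxZ
      have hxoff : ∀ i, 1 ≤ i → i ≤ m → f i ≠ x := by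
        rintro i h1 h3 rfl
        rcases hcover i h1 h3 with h' | h'
        · exact hxZ ⟨i, h', rfl⟩
        · refine hxS ((h.mem_successors hK).2 ⟨i - 1, h', by omega, ?_⟩)
          rw [Nat.sub_add_cancel h1]
      refine hno (hasBipartiteHole_of_independent_of_notMem (x := x) (K := ∅) (I := I)
        subset_rfl hI (by simp) (by simp) hx (by simp) ?_ (by omega) (by simp; omega))
      intro y hy hxy
      rcases Finset.mem_insert.1 hy with rfl | hy
      · rcases hK.closed _ hc x hxy.symm with h' | ⟨i, h1, h3, h4⟩
        · rw [hKc, Finset.mem_singleton] at h'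
          exact hxc h'
        · exact hxoff i h1 h3 h4
      · obtain ⟨a, ha, ham, rfl⟩ := (h.mem_successors hK).1 hy
        rcases ha with rfl | ha
        · have hch := (IsChainFromTo.singleton x (G := G)).append
            (h.isChainFromTo_segment le_rfl (h.one_le hK) le_rfl) hxy
          refine h.false_of_isChain (k := [x]) (r := 0) (by simp) (by simpa using hxoff) hch.1 ?_
            (by simp)
          simp only [← Multiset.coe_add]
          abel
        · exact h.not_adj_succ_of_off hK hc (by simp [hKc]) hxc hxoff h2 ha (hstep a ha) hxy
    · rintro ⟨a, ha, rfl⟩ h'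
      have ham := h.one_lt_of_mem hK ha
      rcases Finset.mem_insert.1 h' with h' | h'
      · exact hK.off c hc a (by omega) (by omega) h'
      · obtain ⟨b, hb, hbm, hfb⟩ := (h.mem_successors hK).1 h'
        have := h.inj (b + 1) a (by omega) (by omega) (by omega) (by omega) hfb
        subst this
        exact h.succ_notMem hK hb ha
  have hcomplc : Iᶜ.card = (G.attachments m f K).card := by
    rw [hcompl, h.card_image_attachments hK]
  refine ⟨I, by omega, hI, ?_⟩
  -- All neighbors of `x` lie in `Iᶜ`, which has exactly `s + t - 3` vertices, the least degree
  -- allowed.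
  intro x hx y hy
  by_contra hxy
  have hy' := Finset.mem_compl.2 hy
  have := hdeg x (Iᶜ.erase y) (by
    intro u hu
    refine Finset.mem_erase.2 ⟨?_, Finset.mem_compl.2 fun huI => hI x hx u huI hu⟩
    rintro rfl
    exact hxy hu)
  rw [Finset.card_erase_of_mem hy'] at this
  have := Finset.card_pos.2 ⟨_, hy'⟩
  omega

end IsLongestPath

/-- The nontraceable graphs in which the degrees are at most two smaller than the hole sizes
require. -/
theorem isTraceable_or_exists [Fintype V] [DecidableEq V] [Nonempty V] (hs : 1 ≤ s) (hst : s ≤ t)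
    (hno : ¬ G.HasBipartiteHole s t)
    (hdeg : ∀ (v : V) (N : Finset V), (∀ u, G.Adj v u → u ∈ N) → s + t ≤ N.card + 3) :
    G.IsTraceable ∨
      (∃ I : Finset V, I.card = Iᶜ.card + 2 ∧ (∀ x ∈ I, ∀ y ∈ I, ¬ G.Adj x y) ∧
        ∀ x ∈ I, ∀ y ∉ I, G.Adj x y) ∨
      ∃ K : Finset V, K.card = Kᶜ.card ∧ (∀ x ∈ K, ∀ y ∈ K, x ≠ y → G.Adj x y) ∧
        (∀ x ∉ K, ∀ y ∉ K, x ≠ y → G.Adj x y) ∧ (∀ x ∈ K, ∀ y ∉ K, ¬ G.Adj x y) := by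
  obtain ⟨m, f, h⟩ := G.exists_isLongestPath
  by_cases hall : ∀ v, ∃ i, 1 ≤ i ∧ i ≤ m ∧ f i = v
  · left
    obtain ⟨v⟩ := ‹Nonempty V›
    obtain ⟨i, h1, h2, -⟩ := hall v
    have hch := h.isChainFromTo_segment le_rfl (h1.trans h2) le_rfl
    have hne : segment f 1 m ≠ [] := by
      intro h'
      simpa [h'] using hch.2.1
    refine ⟨_, _, Walk.ofSupport (segment f 1 m) hne hch.1, fun v => ?_⟩
    rw [Walk.support_ofSupport]
    exact List.count_eq_one_of_mem h.nodup_segment (mem_segment.2 (hall v))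
  · right
    push Not at hall
    obtain ⟨c, hc⟩ := hall
    obtain ⟨K, -, hK⟩ := G.exists_isOffPathComponent (c := c) hc
    rcases (G.attachments m f K).eq_empty_or_nonempty with hZ | hZ
    · exact Or.inr ⟨K, h.two_cliques hK hs hst hno hdeg hZ⟩
    · exact Or.inl (h.independent_join hK hst hno hdeg hZ)

end SimpleGraph

/-! ### The exceptional graphs: nontraceability and isomorphisms -/

namespace SimpleGraph

variable {V : Type*} {G : SimpleGraph V}

/-- A walk visits an independent set at most once more than its complement. -/
theorem countP_le_of_isChain {p : V → Bool} (hp : ∀ x y, p x → p y → ¬ G.Adj x y) :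
    ∀ l : List V, l.IsChain G.Adj → l.countP p ≤ l.countP (fun x => ! p x) + 1
  | [], _ => by simp
  | [x], _ => by
    have := List.countP_le_length (p := p) (l := [x])
    simp only [List.length_singleton] at this
    omega
  | x :: y :: l, h => by
    rw [List.isChain_cons_cons] at h
    -- Two consecutive vertices are removed if one lies outside the set; when the first lies
    -- outside, removing it alone also works.
    have h1 := countP_le_of_isChain hp l h.2.tail
    have h2 := countP_le_of_isChain hp (y :: l) h.2
    have hxy := hp x y
    rw [List.countP_cons, List.countP_cons] at h2
    rw [List.countP_cons, List.countP_cons, List.countP_cons, List.countP_cons]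
    cases hx : p x <;> cases hy : p y <;> simp_all
    omega

theorem not_isTraceable_of_independent [Fintype V] [DecidableEq V] {I : Finset V}
    (hI : ∀ x ∈ I, ∀ y ∈ I, ¬ G.Adj x y) (hc : Iᶜ.card + 1 < I.card) : ¬ G.IsTraceable := by
  rintro ⟨u, v, p, hp⟩
  have h1 := countP_le_of_isChain (G := G) (p := fun x => decide (x ∈ I))
    (fun x y hx hy => hI x (by simpa using hx) y (by simpa using hy))
    p.support p.isChain_adj_support
  have key : ∀ A : Finset V, p.support.countP (fun x => decide (x ∈ A)) = A.card := by
    intro A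
    rw [List.countP_eq_length_filter, ← List.toFinset_card_of_nodup
      (hp.isPath.support_nodup.filter _)]
    congr 1
    ext x
    simp [hp.mem_support x]
  have h2 := key I
  have h3 := key Iᶜ
  simp only [Finset.mem_compl, decide_not] at h3
  omega

theorem not_isTraceable_of_separated [DecidableEq V] {P : V → Prop}
    (hP : ∀ x y, G.Adj x y → (P x ↔ P y)) {a b : V} (ha : P a) (hb : ¬ P b) :
    ¬ G.IsTraceable := by
  rintro ⟨u, v, p, hp⟩
  have key : ∀ {x y : V} (q : G.Walk x y), ∀ z ∈ q.support, (P x ↔ P z) := by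
    intro x y q
    induction q with
    | nil => simp
    | cons hadj q ih =>
      intro z hz
      rw [Walk.support_cons, List.mem_cons] at hz
      rcases hz with rfl | hz
      · rfl
      · exact (hP _ _ hadj).trans (ih z hz)
  exact hb ((key p b (hp.mem_support b)).1 ((key p a (hp.mem_support a)).2 ha))

/-- A set of `b` among `a + b` vertices can be numbered together with its complement. -/
theorem exists_equiv_sum_fin [Fintype V] [DecidableEq V] (I : Finset V) {a b : ℕ}
    (ha : Iᶜ.card = a) (hb : I.card = b) :
    ∃ e : V ≃ Fin a ⊕ Fin b, (∀ x, x ∈ I ↔ ∃ j, e x = Sum.inr j) := by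
  have e1 : {x // x ∈ I} ≃ Fin b := Fintype.equivFinOfCardEq (by simpa using hb)
  have e2 : {x // ¬ x ∈ I} ≃ Fin a := Fintype.equivFinOfCardEq (by
    rw [← ha, Fintype.card_of_subtype Iᶜ]
    simp)
  refine ⟨(Equiv.sumCompl (· ∈ I)).symm.trans ((Equiv.sumCongr e1 e2).trans (Equiv.sumComm _ _)),
    fun x => ?_⟩
  by_cases hx : x ∈ I
  · simp [hx, Equiv.sumCompl_symm_apply_of_pos]
  · simp [hx, Equiv.sumCompl_symm_apply_of_neg]

theorem exists_iso_graphJoin [Fintype V] [DecidableEq V] {I : Finset V} {a b : ℕ}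
    (ha : Iᶜ.card = a) (hb : I.card = b) (hI : ∀ x ∈ I, ∀ y ∈ I, ¬ G.Adj x y)
    (hcross : ∀ x ∈ I, ∀ y ∉ I, G.Adj x y) :
    ∃ H : SimpleGraph (Fin a), Nonempty (G ≃g H.graphJoin (⊥ : SimpleGraph (Fin b))) := by
  obtain ⟨e, he⟩ := exists_equiv_sum_fin I ha hb
  refine ⟨G.comap fun i => e.symm (Sum.inl i), ⟨⟨e, ?_⟩⟩⟩
  intro x y
  have hx := he x
  have hy := he y
  obtain ⟨x, rfl⟩ := e.symm.surjective x
  obtain ⟨y, rfl⟩ := e.symm.surjective y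
  rcases x with x | x <;> rcases y with y | y <;> simp [graphJoin] at hx hy ⊢
  · exact (hcross _ hy _ hx).symm
  · exact hcross _ hx _ hy
  · exact hI _ hx _ hy

theorem exists_iso_sum_top [Fintype V] [DecidableEq V] {K : Finset V} {a : ℕ}
    (ha : Kᶜ.card = a) (hb : K.card = a) (hK : ∀ x ∈ K, ∀ y ∈ K, x ≠ y → G.Adj x y)
    (hO : ∀ x ∉ K, ∀ y ∉ K, x ≠ y → G.Adj x y) (hKO : ∀ x ∈ K, ∀ y ∉ K, ¬ G.Adj x y) :
    Nonempty (G ≃g ((⊤ : SimpleGraph (Fin a)) ⊕g (⊤ : SimpleGraph (Fin a)))) := by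
  obtain ⟨e, he⟩ := exists_equiv_sum_fin K ha hb
  refine ⟨⟨e, ?_⟩⟩
  intro x y
  have hx := he x
  have hy := he y
  obtain ⟨x, rfl⟩ := e.symm.surjective x
  obtain ⟨y, rfl⟩ := e.symm.surjective y
  rcases x with x | x <;> rcases y with y | y <;> simp at hx hy ⊢
  · exact ⟨fun hne => hO _ hx _ hy (by simpa using hne), fun hadj => by simpa using hadj.ne⟩
  · exact fun hadj => hKO _ hy _ hx hadj.symm
  · exact hKO _ hx _ hy
  · exact ⟨fun hne => hK _ hx _ hy (by simpa using hne), fun hadj => by simpa using hadj.ne⟩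

theorem not_isTraceable_of_iso_graphJoin [Fintype V] [DecidableEq V] {a b : ℕ}
    {H : SimpleGraph (Fin a)} (e : G ≃g H.graphJoin (⊥ : SimpleGraph (Fin b)))
    (hab : a + 1 < b) : ¬ G.IsTraceable := by
  let I : Finset V := Finset.univ.image fun j => e.symm (Sum.inr j)
  have hIc : I.card = b := by
    rw [Finset.card_image_of_injective, Finset.card_univ, Fintype.card_fin]
    exact e.symm.injective.comp Sum.inr_injective
  have hV : Fintype.card V = a + b := by
    rw [Fintype.card_congr e.toEquiv]
    simp
  refine not_isTraceable_of_independent (I := I) ?_ (by rw [Finset.card_compl]; omega)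
  intro x hx y hy hxy
  obtain ⟨i, -, rfl⟩ := Finset.mem_image.1 hx
  obtain ⟨j, -, rfl⟩ := Finset.mem_image.1 hy
  rw [e.symm.map_adj_iff] at hxy
  simp [graphJoin] at hxy

theorem not_isTraceable_of_iso_sum [DecidableEq V] {A B : Type*} [Nonempty A] [Nonempty B]
    {H : SimpleGraph A} {H' : SimpleGraph B} (e : G ≃g (H ⊕g H')) : ¬ G.IsTraceable := by
  obtain ⟨a⟩ := ‹Nonempty A›
  obtain ⟨b⟩ := ‹Nonempty B›
  refine not_isTraceable_of_separated (P := fun x => (e x).isLeft) ?_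
    (a := e.symm (Sum.inl a)) (b := e.symm (Sum.inr b)) (by simp) (by simp)
  intro x y hxy
  rw [← e.map_adj_iff] at hxy
  cases hx : e x <;> cases hy : e y <;> simp_all

end SimpleGraph

/-! ### The characterization -/

open SimpleGraph in
theorem mainTheorem4 {V : Type*} [Fintype V] [DecidableEq V] [Nonempty V]
    (G : SimpleGraph V) [DecidableRel G.Adj]
    (hδ : (G.bipartiteHoleNumber : ℤ) - 2 ≤ (G.minDegree : ℤ)) :
    G.IsTraceable ↔
      ¬ (Even (Fintype.card V) ∧
          ((∃ H : SimpleGraph (Fin ((Fintype.card V - 2) / 2)),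
              Nonempty (G ≃g
                H.graphJoin (⊥ : SimpleGraph (Fin ((Fintype.card V + 2) / 2))))) ∨
            Nonempty (G ≃g
              ((⊤ : SimpleGraph (Fin (Fintype.card V / 2))) ⊕g
                (⊤ : SimpleGraph (Fin (Fintype.card V / 2))))))) := by
  have hpos : 0 < Fintype.card V := Fintype.card_pos
  constructor
  · rintro htr ⟨heven, ⟨H, ⟨e⟩⟩ | ⟨⟨e⟩⟩⟩
    -- An even positive order is at least 2, so the truncated subtraction and the divisions are
    -- exact.
    · have := heven.two_dvd
      exact not_isTraceable_of_iso_graphJoin e (by omega) htr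
    · have := heven.two_dvd
      have : Nonempty (Fin (Fintype.card V / 2)) := ⟨⟨0, by omega⟩⟩
      exact not_isTraceable_of_iso_sum e htr
  · intro hex
    obtain ⟨s, t, hs, ht, hst, hno⟩ := Nat.sInf_mem G.bipartiteHoleNumber_set_nonempty
    have hk : s + t = G.bipartiteHoleNumber + 1 := hst
    have hdeg : ∀ (v : V) (N : Finset V), (∀ u, G.Adj v u → u ∈ N) → s + t ≤ N.card + 3 := by
      intro v N hN
      have h1 := G.minDegree_le_degree v
      have h2 : G.degree v ≤ N.card := by
        rw [← G.card_neighborFinset_eq_degree]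
        exact Finset.card_le_card fun u hu => hN u (by simpa using hu)
      omega
    have key : G.IsTraceable ∨
        (∃ I : Finset V, I.card = Iᶜ.card + 2 ∧ (∀ x ∈ I, ∀ y ∈ I, ¬ G.Adj x y) ∧
          ∀ x ∈ I, ∀ y ∉ I, G.Adj x y) ∨
        ∃ K : Finset V, K.card = Kᶜ.card ∧ (∀ x ∈ K, ∀ y ∈ K, x ≠ y → G.Adj x y) ∧
          (∀ x ∉ K, ∀ y ∉ K, x ≠ y → G.Adj x y) ∧ (∀ x ∈ K, ∀ y ∉ K, ¬ G.Adj x y) := by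
      rcases le_total s t with h | h
      · exact isTraceable_or_exists hs h hno hdeg
      · exact isTraceable_or_exists ht h (fun h' => hno h'.symm)
          (by simpa only [add_comm t s] using hdeg)
    rcases key with h | ⟨I, hc, hI, hcross⟩ | ⟨K, hc, hK, hO, hKO⟩
    · exact h
    · have h1 := I.card_add_card_compl
      exact absurd ⟨⟨Iᶜ.card + 1, by omega⟩, Or.inl (exists_iso_graphJoin (by omega) (by omega)
        hI hcross)⟩ hex
    · have h1 := K.card_add_card_compl
      exact absurd ⟨⟨Kᶜ.card, by omega⟩, Or.inr (exists_iso_sum_top (by omega) (by omega)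
        hK hO hKO)⟩ hex
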